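/- Let $\rho_A$ be a density matrix on a finite-dimensional Hilbert space and let $\Lambda(\cdot)=\sum_k A_k(\cdot)A_k^\dagger$, $\sum_k A_k^\dagger A_k=I$, be a quantum channel with finitely many Kraus operators and finite-dimensional output. Put $\rho_B=\Lambda(\rho_A)$ and $\rho_E=\sum_{k,l}\mathrm{Tr}(A_k\rho_A A_l^\dagger)\,|k\rangle\langle l|$. For $X\in\{A,B,E\}$, $n\in\mathbb N$ and $\delta>0$, let $\Pi_X$ be the projector onto the $\delta$-typical subspace of $\rho_X^{\otimes n}$, i.e. the span of the eigenvectors of $\rho_X^{\otimes n}$ with eigenvalue in $[2^{-n(S(\rho_X)+\delta)},2^{-n(S(\rho_X)-\delta)}]$, where $S(\rho)=-\mathrm{Tr}\,\rho\log_2\rho$. Put $d_A=\mathrm{rank}\,\Pi_A$ and $\rho_A^{typ}=\Pi_A\rho_A^{\otimes n}\Pi_A/\mathrm{Tr}(\Pi_A\rho_A^{\otimes n}\Pi_A)$. A uniform source-distorted code with $N$ codewords consists of the random vectors $|\alpha\rangle=\sqrt{d_A}\sqrt{\rho_A^{typ}}\,|\phi_\alpha\rangle$, $\alpha=1,\dots,N$,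 where $\phi_1,\dots,\phi_N$ are independent and uniformly distributed on the unit sphere of the range of $\Pi_A$. For an orthonormal family $(\psi_\alpha)_{\alpha=1}^N$ in a finite-dimensional Hilbert space of Alice put $$|\psi_{ABE}\rangle=\frac{1}{\sqrt{\sum_{\alpha}\langle\alpha|\alpha\rangle}}\sum_{\alpha=1}^N\sum_{k}|\psi_\alpha\rangle_A\otimes A_k|\alpha\rangle_B\otimes|k\rangle_E ,\qquad |\psi'_{ABE}\rangle=\frac1{\sqrt N}\sum_{\alpha=1}^N\sum_{k}|\psi_\alpha\rangle_A\otimes A_k|\alpha\rangle_B\otimes|k\rangle_E ,$$ $$|\tilde\psi_{ABE}\rangle=(I_A\otimes\Pi_B\otimes\Pi_E)\,|\psi'_{ABE}\rangle ,$$ where in these sums $k=(k_1,\dots,k_n)$ and $A_k=A_{k_1}\otimes\cdots\otimes A_{k_n}$. Then for all $\delta>0$, $0<\epsilon<1$ and $\eta>0$ there is $n_0$, depending only on $\rho_A$, $\Lambda$, $\delta$, $\epsilon$, $\eta$, such that for all $n\ge n_0$, all $N\ge1$ and every orthonormal family $(\psi_\alpha)_{\alpha=1}^N$, the typical subspace of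 $A$ is nonzero (so that the random code is well defined) and with probability at least $1-\eta$ over the code $$\bigl\|\,|\psi_{ABE}\rangle\langle\psi_{ABE}|-|\tilde\psi_{ABE}\rangle\langle\tilde\psi_{ABE}|\,\bigr\|\le\epsilon ,$$ where $\|\cdot\|$ is the trace norm. -/

import Mathlib

open MeasureTheory
open scoped Matrix Kronecker MatrixOrder ComplexOrder

noncomputable section

namespace QCode

/-- A density matrix on the Hilbert space with orthonormal basis indexed by `ι`. -/
structure DensityMatrix (ι : Type*) [Fintype ι] where
  mat : Matrix ι ι ℂ
  posSemidef : mat.PosSemidef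
  trace_eq_one : mat.trace = 1

/-- A quantum channel from `ι`-matrices to `β`-matrices, `X ↦ ∑ k, A k * X * (A k)ᴴ`, given by
Kraus operators `A k`; equivalently the isometry `v ↦ ∑ k, A k v ⊗ |k⟩` into receiver `⊗`
environment, where the environment has orthonormal basis indexed by `κ`. -/
structure Channel (ι β κ : Type*) [Fintype ι] [Fintype β] [Fintype κ] [DecidableEq ι] where
  kraus : κ → Matrix β ι ℂ
  sum_conjTranspose_mul : ∑ k, (kraus k)ᴴ * kraus k = 1

section States

variable {ι β κ : Type*} [Fintype ι] [Fintype β] [Fintype κ] [DecidableEq ι]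

/-- The receiver's output state `∑ k, A k ρ (A k)ᴴ`. -/
def Channel.receiver (Λ : Channel ι β κ) (ρ : DensityMatrix ι) : DensityMatrix β where
  mat := ∑ k, Λ.kraus k * ρ.mat * (Λ.kraus k)ᴴ
  posSemidef := Matrix.posSemidef_sum _ fun k _ => ρ.posSemidef.mul_mul_conjTranspose_same _
  trace_eq_one := by
    have h : ∀ k, (Λ.kraus k * ρ.mat * (Λ.kraus k)ᴴ).trace
        = ((Λ.kraus k)ᴴ * Λ.kraus k * ρ.mat).trace := fun k => by
      rw [Matrix.trace_mul_comm, Matrix.mul_assoc]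
    rw [Matrix.trace_sum, Finset.sum_congr rfl fun k _ => h k, ← Matrix.trace_sum,
      ← Finset.sum_mul, Λ.sum_conjTranspose_mul, Matrix.one_mul, ρ.trace_eq_one]

/-- The environment's output state, with entries `⟨k| ρ_E |l⟩ = Tr (A k ρ (A l)ᴴ)`. -/
def Channel.environment (Λ : Channel ι β κ) (ρ : DensityMatrix ι) : DensityMatrix κ where
  mat := Matrix.of fun k l => (Λ.kraus k * ρ.mat * (Λ.kraus l)ᴴ).trace
  posSemidef := by
    have h : (Matrix.of fun k l => (Λ.kraus k * ρ.mat * (Λ.kraus l)ᴴ).trace)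
        = ∑ b : β, (Matrix.of fun k i => Λ.kraus k b i) * ρ.mat *
            (Matrix.of fun k i => Λ.kraus k b i : Matrix κ ι ℂ)ᴴ := by
      ext k l
      simp [Matrix.trace, Matrix.sum_apply, Matrix.mul_apply]
    rw [h]
    exact Matrix.posSemidef_sum _ fun b _ => ρ.posSemidef.mul_mul_conjTranspose_same _
  trace_eq_one := by
    have h := (Λ.receiver ρ).trace_eq_one
    simp only [Channel.receiver, Matrix.trace_sum] at h
    exact h

end States

section Typicality

variable {ι κ : Type*} [Fintype ι] [Fintype κ]

/-- The `n`-fold tensor power `M ⊗ ⋯ ⊗ M`, in the product basis. -/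
def tensorPow (M : Matrix ι κ ℂ) (n : ℕ) : Matrix (Fin n → ι) (Fin n → κ) ℂ :=
  Matrix.of fun x y => ∏ t, M (x t) (y t)

/-- The tensor product `A (k 0) ⊗ ⋯ ⊗ A (k (n-1))`: these are the Kraus operators of the
`n`-fold tensor power of the channel with Kraus operators `A`. -/
def tensorKraus {β σ : Type*} (A : σ → Matrix β ι ℂ) (n : ℕ) (k : Fin n → σ) :
    Matrix (Fin n → β) (Fin n → ι) ℂ :=
  Matrix.of fun y x => ∏ t, A (k t) (y t) (x t)

variable [DecidableEq ι]

/-- The eigenvalues of a density matrix, counted with multiplicity. -/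
def DensityMatrix.eigenvalue (ρ : DensityMatrix ι) : ι → ℝ :=
  ρ.posSemidef.isHermitian.eigenvalues

/-- The unitary whose columns are an orthonormal eigenbasis of `ρ`. -/
def DensityMatrix.eigenbasis (ρ : DensityMatrix ι) : Matrix ι ι ℂ :=
  (ρ.posSemidef.isHermitian.eigenvectorUnitary : Matrix ι ι ℂ)

/-- The von Neumann entropy in bits, `-∑ p log₂ p` over the eigenvalues. -/
def DensityMatrix.entropy (ρ : DensityMatrix ι) : ℝ :=
  ∑ i, Real.negMulLog (ρ.eigenvalue i) / Real.log 2

/-- The sequences `x` for which the eigenvalue `∏ t, p (x t)` of `ρ^{⊗n}` lies in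
`[2^{-n(S(ρ)+δ)}, 2^{-n(S(ρ)-δ)}]`. -/
def DensityMatrix.IsTypical (ρ : DensityMatrix ι) (δ : ℝ) (n : ℕ) (x : Fin n → ι) : Prop :=
  (2 : ℝ) ^ (-(n * (ρ.entropy + δ))) ≤ ∏ t, ρ.eigenvalue (x t) ∧
    ∏ t, ρ.eigenvalue (x t) ≤ (2 : ℝ) ^ (-(n * (ρ.entropy - δ)))

open Classical in
/-- The projector onto the `δ`-typical subspace of `ρ^{⊗n}`, that is, the projector
`∑ |e_x⟩⟨e_x|` over typical `x`, where `e_x = e_{x 0} ⊗ ⋯ ⊗ e_{x (n-1)}` is the product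
eigenbasis of `ρ^{⊗n}`. -/
def DensityMatrix.typicalProj (ρ : DensityMatrix ι) (δ : ℝ) (n : ℕ) :
    Matrix (Fin n → ι) (Fin n → ι) ℂ :=
  tensorPow ρ.eigenbasis n * Matrix.diagonal (fun x => if ρ.IsTypical δ n x then 1 else 0) *
    (tensorPow ρ.eigenbasis n)ᴴ

/-- The typical subspace, as the range of the typical projector. -/
def DensityMatrix.typicalSubspace (ρ : DensityMatrix ι) (δ : ℝ) (n : ℕ) :
    Submodule ℂ (EuclideanSpace ℂ (Fin n → ι)) :=
  LinearMap.range (Matrix.toEuclideanLin (ρ.typicalProj δ n))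

/-- The normalized typical state `Π ρ^{⊗n} Π / Tr (Π ρ^{⊗n} Π)`. -/
def DensityMatrix.typicalState (ρ : DensityMatrix ι) (δ : ℝ) (n : ℕ) :
    Matrix (Fin n → ι) (Fin n → ι) ℂ :=
  (ρ.typicalProj δ n * tensorPow ρ.mat n * ρ.typicalProj δ n).trace⁻¹ •
    (ρ.typicalProj δ n * tensorPow ρ.mat n * ρ.typicalProj δ n)

end Typicality

/-- The uniform probability measure on the unit sphere of a nonzero finite-dimensional complex
inner product space: normalized surface measure. -/
def uniformSphere (E : Type*) [NormedAddCommGroup E] [InnerProductSpace ℂ E]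
    [FiniteDimensional ℂ E] [MeasurableSpace E] [BorelSpace E] :
    Measure (Metric.sphere (0 : E) 1) :=
  letI : InnerProductSpace ℝ E := InnerProductSpace.complexToReal
  haveI : FiniteDimensional ℝ E := FiniteDimensional.complexToReal E
  ((volume : Measure E).toSphere Set.univ)⁻¹ • (volume : Measure E).toSphere

section Codes

variable {ι : Type*} [Fintype ι] [DecidableEq ι]

/-- `N` independent uniformly distributed unit vectors in the typical subspace of the source;
the randomness of a uniform source-distorted code with `N` codewords. -/
def codeMeasure (ρ : DensityMatrix ι) (δ : ℝ) (n N : ℕ) :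
    Measure (Fin N → Metric.sphere (0 : ρ.typicalSubspace δ n) 1) :=
  Measure.pi fun _ => uniformSphere (ρ.typicalSubspace δ n)

/-- The codeword `|α⟩ = √d_A √(ρ_A^typ) |φ⟩`, with `d_A` the dimension of the typical subspace and
`φ` a unit vector in it. -/
def codeword (ρ : DensityMatrix ι) (δ : ℝ) (n : ℕ)
    (φ : Metric.sphere (0 : ρ.typicalSubspace δ n) 1) : (Fin n → ι) → ℂ :=
  (Real.sqrt (Module.finrank ℂ (ρ.typicalSubspace δ n)) : ℂ) •
    (CFC.sqrt (ρ.typicalState δ n) *ᵥ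
      ((φ : ρ.typicalSubspace δ n) : EuclideanSpace ℂ (Fin n → ι)).ofLp)

end Codes

section JointStates

variable {ι β κ a : Type*} [Fintype ι] [Fintype β] [Fintype κ] [Fintype a] [DecidableEq ι]
  {n N : ℕ}

/-- The vector `∑ α, ∑ k, |ψ_α⟩_A ⊗ A_k |c_α⟩_B ⊗ |k⟩_E`, in which `A_k` runs over the Kraus
operators of the `n`-fold tensor power of the channel. -/
def outputSum (Λ : Channel ι β κ) (ψ : Fin N → EuclideanSpace ℂ a)
    (c : Fin N → (Fin n → ι) → ℂ) : a × (Fin n → β) × (Fin n → κ) → ℂ :=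
  fun z => ∑ α, ψ α z.1 * (tensorKraus Λ.kraus n z.2.2 *ᵥ c α) z.2.1

/-- The actual (normalized) joint state `ψ_ABE`, with prefactor `1 / √(∑ α, ⟨c_α|c_α⟩)`. -/
def actualState (Λ : Channel ι β κ) (ψ : Fin N → EuclideanSpace ℂ a)
    (c : Fin N → (Fin n → ι) → ℂ) : a × (Fin n → β) × (Fin n → κ) → ℂ :=
  ((Real.sqrt (∑ α, ∑ x, ‖c α x‖ ^ 2))⁻¹ : ℂ) • outputSum Λ ψ c

/-- The unnormalized joint state `ψ'_ABE`, with prefactor `1 / √N`. -/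
def unnormalizedState (Λ : Channel ι β κ) (ψ : Fin N → EuclideanSpace ℂ a)
    (c : Fin N → (Fin n → ι) → ℂ) : a × (Fin n → β) × (Fin n → κ) → ℂ :=
  ((Real.sqrt N)⁻¹ : ℂ) • outputSum Λ ψ c

/-- The projected state `(I_A ⊗ Π_B ⊗ Π_E) ψ'_ABE`. -/
def projectedState [DecidableEq β] [DecidableEq κ] [DecidableEq a]
    (ρ : DensityMatrix ι) (Λ : Channel ι β κ) (δ : ℝ)
    (ψ : Fin N → EuclideanSpace ℂ a) (c : Fin N → (Fin n → ι) → ℂ) :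
    a × (Fin n → β) × (Fin n → κ) → ℂ :=
  ((1 : Matrix a a ℂ) ⊗ₖ
    ((Λ.receiver ρ).typicalProj δ n ⊗ₖ (Λ.environment ρ).typicalProj δ n)) *ᵥ
      unnormalizedState Λ ψ c

end JointStates

/-- The rank-one operator `|v⟩⟨v|`. -/
def outer {m : Type*} (v : m → ℂ) : Matrix m m ℂ := Matrix.vecMulVec v (star v)

/-- The trace norm: the sum of the singular values. -/
def traceNorm {m : Type*} [Fintype m] [DecidableEq m] (M : Matrix m m ℂ) : ℝ :=
  (Matrix.toEuclideanLin M).singularValues.sum fun _ s => s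

end QCode

end

/-! Write `W` for the Stinespring isometry of the `n`-fold channel and `K` for `Π_B ⊗ Π_E`.
Everything is measured by one nonnegative quantity per codeword `c`, its `defect` `(‖c‖² - 1)² + ‖(1
- K) W c‖²`.

Deterministic half (`traceNorm_actualState_sub_projectedState_le`): since the `ψ_α` are orthonormal,
squared norms of the joint vectors are sums over codewords. If the average defect of the code is at
most `s²`, then renormalizing moves the vector by at most `s`, and so does projecting. The two
rank-one operators are then within `12 * s` in trace norm.

Probabilistic half (`eventually_integral_defect_le`): the mean defect of one random codeword tends
to `0`. The norm term is a variance on the sphere. The fourth moments, obtained from unitary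
invariance alone, bound it by the purity of the typical state. That purity is at most the `n`-th
power of the purity of `ρ`, divided by the squared typical weight, so it decays unless `ρ` is pure;
in that case all codewords have norm exactly one. For the projection term, the mean of `|c⟩⟨c|` is
the typical state, which is at most `ρ^{⊗n}` divided by the typical weight. What remains is the
weight of the joint output outside `K`. A union bound for commuting projectors reduces it to the
atypical weights of `ρ_B^{⊗n}` and `ρ_E^{⊗n}`, which vanish by Chebyshev.

The average defect of a code has the same mean as the defect of one codeword, so Markov's inequality
gives an `n₀` that does not depend on `N`. Only the marginal laws of the codewords matter. -/

noncomputable section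

namespace QCode

/-! ### Second and fourth moments of a uniform unit vector -/

section Sphere

variable {E : Type*} [NormedAddCommGroup E] [InnerProductSpace ℂ E]

/-- The self-map of the unit sphere induced by a linear isometry. -/
def sphereMap (U : E ≃ₗᵢ[ℂ] E) (φ : Metric.sphere (0 : E) 1) : Metric.sphere (0 : E) 1 :=
  ⟨U φ, by simp⟩

lemma continuous_sphereMap (U : E ≃ₗᵢ[ℂ] E) : Continuous (sphereMap U) :=
  (U.continuous.comp continuous_subtype_val).subtype_mk _

/-- Transitivity of the unitary group on the unit sphere: the isometry between the two lines extends
to the whole space, and is onto by finite dimension. -/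
lemma exists_isometryEquiv_apply_eq [FiniteDimensional ℂ E] {w w' : E}
    (hw : ‖w‖ = 1) (hw' : ‖w'‖ = 1) :
    ∃ U : E ≃ₗᵢ[ℂ] E, U w = w' := by
  let L : (Submodule.span ℂ {w}) →ₗᵢ[ℂ] E := (LinearIsometry.toSpanSingleton ℂ E hw').comp
    (LinearIsometryEquiv.toSpanUnitSingleton w hw).symm.toLinearIsometry
  refine ⟨L.extend.toLinearIsometryEquiv rfl, ?_⟩
  have h1 := L.extend_apply ⟨w, Submodule.mem_span_singleton_self w⟩
  have h2 : (⟨w, Submodule.mem_span_singleton_self w⟩ : Submodule.span ℂ {w})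
      = LinearIsometryEquiv.toSpanUnitSingleton w hw 1 := by
    ext; simp
  simp only [LinearIsometry.coe_toLinearIsometryEquiv]
  rw [h1]
  change LinearIsometry.toSpanSingleton ℂ E hw'
    ((LinearIsometryEquiv.toSpanUnitSingleton w hw).symm _) = w'
  rw [h2, LinearIsometryEquiv.symm_apply_apply]
  simp

variable [FiniteDimensional ℂ E] [MeasurableSpace E] [BorelSpace E]

lemma isProbabilityMeasure_uniformSphere [Nontrivial E] :
    IsProbabilityMeasure (uniformSphere E) := by
  let _ : InnerProductSpace ℝ E := InnerProductSpace.complexToReal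
  have : FiniteDimensional ℝ E := FiniteDimensional.complexToReal E
  constructor
  have h0 : (volume : Measure E).toSphere Set.univ ≠ 0 := by
    rw [Ne, Measure.measure_univ_eq_zero]
    exact Measure.toSphere_ne_zero _
  exact ENNReal.inv_mul_cancel h0 (measure_ne_top _ _)

open scoped Pointwise in
lemma measurePreserving_sphereMap (U : E ≃ₗᵢ[ℂ] E) :
    MeasurePreserving (sphereMap U) (uniformSphere E) (uniformSphere E) := by
  let _ : InnerProductSpace ℝ E := InnerProductSpace.complexToReal
  have : FiniteDimensional ℝ E := FiniteDimensional.complexToReal E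
  refine ⟨(continuous_sphereMap U).measurable, ?_⟩
  -- Surface measure of a set is, up to a constant factor, the volume of the cone over it. Taking
  -- cones commutes with `U`, which is a real isometry and so preserves volume.
  have key : (volume : Measure E).toSphere.map (sphereMap U) = (volume : Measure E).toSphere := by
    ext s hs
    have hm := (continuous_sphereMap U).measurable
    rw [Measure.map_apply hm hs, Measure.toSphere_apply' _ (hm hs), Measure.toSphere_apply' _ hs]
    congr 1
    let V : E ≃ₗᵢ[ℝ] E := ⟨U.toLinearEquiv.restrictScalars ℝ, U.norm_map⟩
    have hV : ∀ x, V x = U x := fun _ => rfl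
    have hset : Set.Ioo (0 : ℝ) 1 • ((↑) '' (sphereMap U ⁻¹' s) : Set E)
        = V ⁻¹' (Set.Ioo (0 : ℝ) 1 • ((↑) '' s : Set E)) := by
      ext x
      simp only [Set.mem_smul, Set.mem_image, Set.mem_preimage]
      constructor
      · rintro ⟨t, ht, _, ⟨y, hy, rfl⟩, rfl⟩
        exact ⟨t, ht, _, ⟨_, hy, rfl⟩, (V.map_smul t (y : E)).symm⟩
      · rintro ⟨t, ht, _, ⟨y, hy, rfl⟩, h⟩
        refine ⟨t, ht, _, ⟨⟨V.symm y, by simp⟩, ?_, rfl⟩, ?_⟩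
        · convert hy
          simp [sphereMap, ← hV]
        · apply V.injective
          simp [← h]
    rw [hset, V.measurePreserving.measure_preimage_emb
      V.toHomeomorph.measurableEmbedding]
  change Measure.map (sphereMap U) (((volume : Measure E).toSphere Set.univ)⁻¹ •
    (volume : Measure E).toSphere) = ((volume : Measure E).toSphere Set.univ)⁻¹ •
    (volume : Measure E).toSphere
  rw [Measure.map_smul, key]

/-- A continuous function on the sphere is integrable for the uniform measure. -/
lemma integrable_uniformSphere [Nontrivial E] {f : Metric.sphere (0 : E) 1 → ℝ}
    (hf : Continuous f) : Integrable f (uniformSphere E) := by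
  have := isProbabilityMeasure_uniformSphere (E := E)
  have : ProperSpace E := FiniteDimensional.proper ℂ E
  exact hf.integrable_of_hasCompactSupport (HasCompactSupport.of_compactSpace f)

lemma integral_norm_inner_pow_eq {w w' : E} (hw : ‖w‖ = 1) (hw' : ‖w'‖ = 1) (p : ℕ) :
    ∫ φ, ‖inner ℂ w (φ : E)‖ ^ p ∂uniformSphere E
      = ∫ φ, ‖inner ℂ w' (φ : E)‖ ^ p ∂uniformSphere E := by
  obtain ⟨U, rfl⟩ := exists_isometryEquiv_apply_eq hw hw'
  have hU := measurePreserving_sphereMap U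
  have hc : Continuous fun φ : Metric.sphere (0 : E) 1 => ‖inner ℂ (U w) (φ : E)‖ ^ p := by
    fun_prop
  rw [← hU.map_eq, integral_map hU.measurable.aemeasurable
    hc.measurable.aestronglyMeasurable, hU.map_eq]
  simp [sphereMap]

variable [Nontrivial E]

/-- By symmetry all vectors of an orthonormal basis give the same mean, and by Parseval these means
add up to one. -/
lemma integral_norm_inner_sq (w : E) :
    ∫ φ, ‖inner ℂ w (φ : E)‖ ^ 2 ∂uniformSphere E = ‖w‖ ^ 2 / Module.finrank ℂ E := by
  have := isProbabilityMeasure_uniformSphere (E := E)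
  have hd : (Module.finrank ℂ E : ℝ) ≠ 0 := by exact_mod_cast Module.finrank_pos.ne'
  have unit : ∀ v : E, ‖v‖ = 1 →
      ∫ φ, ‖inner ℂ v (φ : E)‖ ^ 2 ∂uniformSphere E = 1 / Module.finrank ℂ E := by
    intro v hv
    have b := stdOrthonormalBasis ℂ E
    have h1 : ∫ φ : Metric.sphere (0 : E) 1, ∑ i, ‖inner ℂ (b i) (φ : E)‖ ^ 2 ∂uniformSphere E
        = 1 := by
      simp [b.sum_sq_norm_inner_right]
    rw [integral_finsetSum _ fun i _ => integrable_uniformSphere (by fun_prop)] at h1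
    rw [Finset.sum_congr rfl fun i _ => integral_norm_inner_pow_eq (b.norm_eq_one i) hv 2] at h1
    simp only [Finset.sum_const, Finset.card_univ, Fintype.card_fin, nsmul_eq_mul] at h1
    field_simp
    linarith
  by_cases hw : w = 0
  · simp [hw]
  have hn : ‖w‖ ≠ 0 := norm_ne_zero_iff.mpr hw
  have h := unit ((‖w‖⁻¹ : ℂ) • w) (by simp [norm_smul, hn])
  simp only [inner_smul_left, norm_mul, mul_pow] at h
  rw [integral_const_mul] at h
  simp only [map_inv₀, Complex.conj_ofReal, norm_inv, Complex.norm_real, norm_norm] at h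
  field_simp at h ⊢
  linarith

/-- The mean of `‖T φ‖ ^ 2` for a uniform unit vector `φ`. -/
lemma integral_norm_map_sq {F κ : Type*} [NormedAddCommGroup F] [InnerProductSpace ℂ F]
    [FiniteDimensional ℂ F] [Fintype κ] (b : OrthonormalBasis κ ℂ E) (T : E →ₗ[ℂ] F) :
    ∫ φ, ‖T (φ : E)‖ ^ 2 ∂uniformSphere E = (∑ i, ‖T (b i)‖ ^ 2) / Module.finrank ℂ E := by
  have c := stdOrthonormalBasis ℂ F
  have h : ∀ v : E, ‖T v‖ ^ 2 = ∑ k, ‖inner ℂ (T.adjoint (c k)) v‖ ^ 2 := by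
    intro v
    simp_rw [LinearMap.adjoint_inner_left]
    exact (c.sum_sq_norm_inner_right _).symm
  simp_rw [h]
  rw [integral_finsetSum _ fun i _ => integrable_uniformSphere (by fun_prop)]
  simp_rw [integral_norm_inner_sq]
  rw [Finset.sum_comm, Finset.sum_div]
  refine Finset.sum_congr rfl fun k _ => ?_
  rw [b.sum_sq_norm_inner_left]

/-- Averaging over the four phases `1, -1, I, -I` kills the terms linear in the real part of the
cross term and leaves only `‖u‖ ^ 2 * ‖v‖ ^ 2`. -/
lemma norm_add_pow_four_sum (u v : ℂ) :
    ‖u + v‖ ^ 4 + ‖u - v‖ ^ 4 + ‖u + Complex.I * v‖ ^ 4 + ‖u - Complex.I * v‖ ^ 4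
      = 4 * (‖u‖ ^ 4 + ‖v‖ ^ 4) + 16 * (‖u‖ ^ 2 * ‖v‖ ^ 2) := by
  have h : ∀ z : ℂ, ‖z‖ ^ 4 = (z.re * z.re + z.im * z.im) ^ 2 := fun z => by
    rw [← Complex.normSq_apply, Complex.normSq_eq_norm_sq]; ring
  have h2 : ∀ z : ℂ, ‖z‖ ^ 2 = z.re * z.re + z.im * z.im := fun z => by
    rw [← Complex.normSq_apply, Complex.normSq_eq_norm_sq]
  simp only [h, h2, Complex.add_re, Complex.add_im, Complex.sub_re, Complex.sub_im,
    Complex.mul_re, Complex.mul_im, Complex.I_re, Complex.I_im]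
  ring

/-- Each `(v + c • w) / √2` with `‖c‖ = 1` is again a unit vector, so it has the same fourth moment
`M` as `v`. Summing over four phases gives `16 M = 8 M + 16 X` for the mixed moment `X`. -/
lemma integral_norm_inner_sq_mul {v w : E} (hv : ‖v‖ = 1) (hw : ‖w‖ = 1)
    (hvw : inner ℂ v w = 0) :
    ∫ φ, ‖inner ℂ v (φ : E)‖ ^ 2 * ‖inner ℂ w (φ : E)‖ ^ 2 ∂uniformSphere E
      = (∫ φ, ‖inner ℂ v (φ : E)‖ ^ 4 ∂uniformSphere E) / 2 := by
  have hs : (0 : ℝ) < √2 := by positivity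
  have hs2 : √2 ^ 2 = (2 : ℝ) := Real.sq_sqrt (by norm_num)
  have hs4 : √2 ^ 4 = (4 : ℝ) := by
    calc √2 ^ 4 = (√2 ^ 2) ^ 2 := by ring
      _ = 4 := by rw [hs2]; norm_num
  have hu : ∀ c : ℂ, ‖c‖ = 1 → ‖((√2)⁻¹ : ℂ) • (v + c • w)‖ = 1 := by
    intro c hc
    have h := norm_add_sq_eq_norm_sq_add_norm_sq_of_inner_eq_zero (𝕜 := ℂ) v (c • w)
      (by simp [inner_smul_right, hvw])
    rw [norm_smul c, hc, hv, hw] at h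
    have h' : ‖v + c • w‖ = √2 := by
      rw [← Real.sqrt_sq (norm_nonneg (v + c • w)), sq, h]; norm_num
    rw [norm_smul, h']
    simp [abs_of_pos hs]
  have h4 : ∀ c : ℂ, ‖c‖ = 1 →
      ∫ φ, ‖inner ℂ v (φ : E) + (starRingEnd ℂ c) * inner ℂ w (φ : E)‖ ^ 4 ∂uniformSphere E
        = 4 * ∫ φ, ‖inner ℂ v (φ : E)‖ ^ 4 ∂uniformSphere E := by
    intro c hc
    have h := integral_norm_inner_pow_eq (hu c hc) hv 4
    rw [← h]
    simp only [inner_smul_left, inner_add_left, norm_mul, mul_pow]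
    rw [integral_const_mul]
    simp only [map_inv₀, Complex.conj_ofReal, norm_inv, Complex.norm_real,
      Real.norm_eq_abs, abs_of_pos hs, inv_pow, hs4]
    ring
  have e1 := h4 1 (by simp)
  have e2 := h4 (-1) (by simp)
  have e3 := h4 Complex.I (by simp)
  have e4 := h4 (-Complex.I) (by simp)
  have hw4 := integral_norm_inner_pow_eq hw hv 4
  simp only [map_one, map_neg, Complex.conj_I, one_mul, neg_mul, neg_neg, ← sub_eq_add_neg]
    at e1 e2 e3 e4
  have hsum : ∫ φ : Metric.sphere (0 : E) 1, (‖inner ℂ v (φ : E) + inner ℂ w (φ : E)‖ ^ 4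
      + ‖inner ℂ v (φ : E) - inner ℂ w (φ : E)‖ ^ 4
      + ‖inner ℂ v (φ : E) + Complex.I * inner ℂ w (φ : E)‖ ^ 4
      + ‖inner ℂ v (φ : E) - Complex.I * inner ℂ w (φ : E)‖ ^ 4) ∂uniformSphere E
      = ∫ φ : Metric.sphere (0 : E) 1, (4 * (‖inner ℂ v (φ : E)‖ ^ 4 + ‖inner ℂ w (φ : E)‖ ^ 4)
        + 16 * (‖inner ℂ v (φ : E)‖ ^ 2 * ‖inner ℂ w (φ : E)‖ ^ 2)) ∂uniformSphere E :=
    integral_congr_ae (Filter.Eventually.of_forall fun φ => norm_add_pow_four_sum _ _)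
  rw [integral_add (integrable_uniformSphere (by fun_prop))
      (integrable_uniformSphere (by fun_prop)),
    integral_add (integrable_uniformSphere (by fun_prop))
      (integrable_uniformSphere (by fun_prop)),
    integral_add (integrable_uniformSphere (by fun_prop))
      (integrable_uniformSphere (by fun_prop)), e1, e2, e3, e4,
    integral_add (integrable_uniformSphere (by fun_prop))
      (integrable_uniformSphere (by fun_prop)), integral_const_mul, integral_const_mul,
    integral_add (integrable_uniformSphere (by fun_prop))
      (integrable_uniformSphere (by fun_prop)), hw4] at hsum
  linarith

variable {κ : Type*} [Fintype κ]

/-- The second moment of a diagonal quadratic form of a uniform unit vector. -/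
lemma integral_quadraticForm_sq (b : OrthonormalBasis κ ℂ E) (r : κ → ℝ) :
    ∫ φ, (∑ i, r i * ‖inner ℂ (b i) (φ : E)‖ ^ 2) ^ 2 ∂uniformSphere E
      = (∑ i, r i ^ 2 + (∑ i, r i) ^ 2) /
        (Module.finrank ℂ E * (Module.finrank ℂ E + 1)) := by
  classical
  have := isProbabilityMeasure_uniformSphere (E := E)
  have hd : (0 : ℝ) < Module.finrank ℂ E := by exact_mod_cast Module.finrank_pos
  have hcard : Fintype.card κ = Module.finrank ℂ E :=
    (Module.finrank_eq_card_basis b.toBasis).symm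
  have : Nonempty κ := Fintype.card_pos_iff.mp (hcard ▸ Module.finrank_pos)
  obtain ⟨i₀⟩ := ‹Nonempty κ›
  set m := (∫ φ, ‖inner ℂ (b i₀) (φ : E)‖ ^ 4 ∂uniformSphere E) / 2
  have hG : ∀ i j, ∫ φ, ‖inner ℂ (b i) (φ : E)‖ ^ 2 * ‖inner ℂ (b j) (φ : E)‖ ^ 2
      ∂uniformSphere E = m * (1 + if i = j then 1 else 0) := by
    intro i j
    have h4 := integral_norm_inner_pow_eq (b.norm_eq_one i) (b.norm_eq_one i₀) 4
    split_ifs with hij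
    · subst hij
      have : ∀ φ : Metric.sphere (0 : E) 1, ‖inner ℂ (b i) (φ : E)‖ ^ 2 *
          ‖inner ℂ (b i) (φ : E)‖ ^ 2 = ‖inner ℂ (b i) (φ : E)‖ ^ 4 := fun φ => by ring
      simp_rw [this]
      rw [h4]; ring
    · rw [integral_norm_inner_sq_mul (b.norm_eq_one i) (b.norm_eq_one j)
        (b.orthonormal.inner_eq_zero hij), h4]
      ring
  have hr : ∀ r : κ → ℝ, ∫ φ, (∑ i, r i * ‖inner ℂ (b i) (φ : E)‖ ^ 2) ^ 2 ∂uniformSphere E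
      = m * (∑ i, r i ^ 2 + (∑ i, r i) ^ 2) := by
    intro r
    have : ∀ φ : Metric.sphere (0 : E) 1, (∑ i, r i * ‖inner ℂ (b i) (φ : E)‖ ^ 2) ^ 2
        = ∑ i, ∑ j, (r i * r j) *
          (‖inner ℂ (b i) (φ : E)‖ ^ 2 * ‖inner ℂ (b j) (φ : E)‖ ^ 2) := by
      intro φ
      rw [sq, Finset.sum_mul_sum]
      exact Finset.sum_congr rfl fun i _ => Finset.sum_congr rfl fun j _ => by ring
    simp_rw [this]
    rw [integral_finsetSum _ fun i _ => integrable_uniformSphere (by fun_prop)]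
    rw [Finset.sum_congr rfl fun i _ => integral_finsetSum _ fun j _ =>
      integrable_uniformSphere (by fun_prop)]
    simp_rw [integral_const_mul, hG]
    simp only [mul_add, mul_ite, mul_one, mul_zero, Finset.sum_add_distrib,
      Finset.sum_ite_eq, Finset.mem_univ, if_true]
    rw [sq (∑ i, r i), Finset.sum_mul_sum, Finset.mul_sum, Finset.mul_sum, add_comm]
    congr 1
    · exact Finset.sum_congr rfl fun i _ => by ring
    · refine Finset.sum_congr rfl fun i _ => ?_
      rw [Finset.mul_sum]
      exact Finset.sum_congr rfl fun i _ => by ring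
  -- The unknown `m` is fixed by the constant form, which equals `1` on the sphere: `m * (d + d ^ 2)
  -- = 1`.
  have h1 := hr fun _ => 1
  simp only [one_mul, b.sum_sq_norm_inner_right, norm_eq_of_mem_sphere, one_pow,
    Finset.sum_const, Finset.card_univ, hcard, nsmul_eq_mul, mul_one, integral_const,
    probReal_univ, smul_eq_mul] at h1
  rw [hr, eq_div_iff (by positivity)]
  linear_combination (-(∑ i, r i ^ 2 + (∑ i, r i) ^ 2)) * h1

/-- Concentration of a diagonal quadratic form of trace one. -/
lemma integral_quadraticForm_sub_one_sq_le (b : OrthonormalBasis κ ℂ E) (r : κ → ℝ)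
    (hr : ∑ i, r i = 1) :
    ∫ φ, (Module.finrank ℂ E * ∑ i, r i * ‖inner ℂ (b i) (φ : E)‖ ^ 2 - 1) ^ 2 ∂uniformSphere E
      ≤ ∑ i, r i ^ 2 := by
  have := isProbabilityMeasure_uniformSphere (E := E)
  have hd : (0 : ℝ) < Module.finrank ℂ E := by exact_mod_cast Module.finrank_pos
  set d : ℝ := (Module.finrank ℂ E : ℝ)
  have h1 : ∫ φ, (∑ i, r i * ‖inner ℂ (b i) (φ : E)‖ ^ 2) ∂uniformSphere E = 1 / d := by
    rw [integral_finsetSum _ fun i _ => integrable_uniformSphere (by fun_prop)]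
    simp_rw [integral_const_mul, integral_norm_inner_sq, b.norm_eq_one]
    rw [← Finset.sum_mul, hr]; simp [d]
  have h2 := integral_quadraticForm_sq b r
  rw [hr] at h2
  have h3 : ∀ φ : Metric.sphere (0 : E) 1,
      (d * ∑ i, r i * ‖inner ℂ (b i) (φ : E)‖ ^ 2 - 1) ^ 2
      = d ^ 2 * (∑ i, r i * ‖inner ℂ (b i) (φ : E)‖ ^ 2) ^ 2
        - 2 * d * (∑ i, r i * ‖inner ℂ (b i) (φ : E)‖ ^ 2) + 1 := fun φ => by ring
  simp_rw [h3]
  rw [integral_add (integrable_uniformSphere (by fun_prop)) (integrable_const _),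
    integral_sub (integrable_uniformSphere (by fun_prop))
      (integrable_uniformSphere (by fun_prop)), integral_const_mul, integral_const_mul, h1, h2]
  simp only [integral_const, probReal_univ, smul_eq_mul]
  have hS : 0 ≤ ∑ i, r i ^ 2 := Finset.sum_nonneg fun i _ => sq_nonneg _
  set S := ∑ i, r i ^ 2
  have e : d ^ 2 * ((S + 1 ^ 2) / (d * (d + 1))) - 2 * d * (1 / d) + 1 * 1
      = (d * S - 1) / (d + 1) := by
    field_simp
    ring
  change d ^ 2 * ((S + 1 ^ 2) / (d * (d + 1))) - 2 * d * (1 / d) + 1 * 1 ≤ S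
  rw [e, div_le_iff₀ (by positivity)]
  linarith

end Sphere

/-! ### Trace norm of a difference of rank-one operators -/

section TraceNorm

variable {m : Type*} [Fintype m] [DecidableEq m]

lemma toEuclideanLin_outer_apply (u : m → ℂ) (x : EuclideanSpace ℂ m) :
    Matrix.toEuclideanLin (outer u) x = inner ℂ (WithLp.toLp 2 u) x • WithLp.toLp 2 u := by
  ext i
  simp [outer, Matrix.toLpLin_apply, Matrix.vecMulVec_mulVec, EuclideanSpace.inner_eq_star_dotProduct,
    dotProduct_comm, mul_comm]

/-- The squared singular value is an eigenvalue of the adjoint composed with `T`, so on an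
eigenvector `x` one has `‖T x‖ = σ * ‖x‖`. -/
lemma singularValues_le_of_norm_le {E : Type*} [NormedAddCommGroup E] [InnerProductSpace ℂ E]
    [FiniteDimensional ℂ E] (T : E →ₗ[ℂ] E) {C : ℝ} (hC : 0 ≤ C) (hT : ∀ x, ‖T x‖ ≤ C * ‖x‖)
    (i : ℕ) : T.singularValues i ≤ C := by
  by_cases hi : Module.finrank ℂ E ≤ i
  · rw [T.singularValues_of_finrank_le hi]; exact hC
  push Not at hi
  obtain ⟨x, hx⟩ := (T.hasEigenvalue_adjoint_comp_self_sq_singularValues hi).exists_hasEigenvector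
  have hx0 : 0 < ‖x‖ := norm_pos_iff.mpr hx.2
  have h1 := hx.apply_eq_smul
  have h2 : ‖T x‖ ^ 2 = T.singularValues i ^ 2 * ‖x‖ ^ 2 := by
    have h3 : (inner ℂ (T x) (T x) : ℂ) = (T.singularValues i ^ 2 * ‖x‖ ^ 2 : ℝ) := by
      rw [← LinearMap.adjoint_inner_right, ← LinearMap.comp_apply, h1, inner_smul_right,
        inner_self_eq_norm_sq_to_K]
      push_cast
      simp
    rw [inner_self_eq_norm_sq_to_K] at h3
    rw [← RCLike.ofReal_pow] at h3
    exact Complex.ofReal_injective h3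
  have h4 := pow_le_pow_left₀ (norm_nonneg _) (hT x) 2
  rw [h2, mul_pow] at h4
  exact le_of_sq_le_sq (le_of_mul_le_mul_right h4 (by positivity)) hC

/-- A rank-two bound for the trace norm of the difference of two rank-one operators. -/
lemma traceNorm_outer_sub_outer_le (u v : m → ℂ) :
    traceNorm (outer u - outer v) ≤
      2 * ((‖WithLp.toLp 2 u‖ + ‖WithLp.toLp 2 v‖) * ‖WithLp.toLp 2 (u - v)‖) := by
  set T := Matrix.toEuclideanLin (outer u - outer v) with hT
  set u' := WithLp.toLp 2 u
  set v' := WithLp.toLp 2 v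
  have huv : WithLp.toLp 2 (u - v) = u' - v' := rfl
  rw [huv]
  set C := (‖u'‖ + ‖v'‖) * ‖u' - v'‖
  have hC : 0 ≤ C := by positivity
  have hTx : ∀ x, T x = inner ℂ u' x • u' - inner ℂ v' x • v' := fun x => by
    rw [hT, map_sub, LinearMap.sub_apply, toEuclideanLin_outer_apply, toEuclideanLin_outer_apply]
  have hbound : ∀ x, ‖T x‖ ≤ C * ‖x‖ := fun x => by
    have : T x = inner ℂ u' x • (u' - v') + inner ℂ (u' - v') x • v' := by
      rw [hTx, inner_sub_left, smul_sub, sub_smul]; abel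
    rw [this]
    refine (norm_add_le _ _).trans ?_
    rw [norm_smul, norm_smul]
    have h1 := norm_inner_le_norm (𝕜 := ℂ) u' x
    have h2 := norm_inner_le_norm (𝕜 := ℂ) (u' - v') x
    calc _ ≤ ‖u'‖ * ‖x‖ * ‖u' - v'‖ + ‖u' - v'‖ * ‖x‖ * ‖v'‖ := by gcongr
      _ = C * ‖x‖ := by simp only [C]; ring
  -- The support of the singular values has cardinality equal to the rank, so at most two of them
  -- contribute to the trace norm.
  have hrank : Module.finrank ℂ (LinearMap.range T) ≤ 2 := by
    have hle : LinearMap.range T ≤ Submodule.span ℂ (({u', v'} : Finset _) : Set _) := by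
      rintro _ ⟨x, rfl⟩
      rw [hTx]
      exact sub_mem (Submodule.smul_mem _ _ (Submodule.subset_span (by simp)))
        (Submodule.smul_mem _ _ (Submodule.subset_span (by simp)))
    exact (Submodule.finrank_mono hle).trans
      ((finrank_span_finset_le_card _).trans Finset.card_le_two)
  calc traceNorm (outer u - outer v) = ∑ i ∈ T.singularValues.support, T.singularValues i := rfl
    _ ≤ ∑ i ∈ T.singularValues.support, C :=
      Finset.sum_le_sum fun i _ => singularValues_le_of_norm_le T hC hbound i
    _ = Module.finrank ℂ (LinearMap.range T) * C := by
      rw [Finset.sum_const, T.card_support_singularValues, nsmul_eq_mul]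
    _ ≤ 2 * C := by gcongr; exact_mod_cast hrank

end TraceNorm

/-! ### Weight of the typical subspace: Chebyshev's inequality -/

section Typical

variable {ι : Type*} [Fintype ι]

/-- The variance of a sum of independent centred variables. -/
lemma sum_prod_mul_sum_sq (p f : ι → ℝ) (hp : ∑ i, p i = 1) (hf : ∑ i, p i * f i = 0) (n : ℕ) :
    ∑ x : Fin n → ι, (∏ t, p (x t)) * (∑ t, f (x t)) ^ 2 = n * ∑ i, p i * f i ^ 2 := by
  have hone : ∀ n, ∑ x : Fin n → ι, ∏ t, p (x t) = 1 := fun n => by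
    rw [← Fintype.sum_pow, hp, one_pow]
  induction n with
  | zero => simp
  | succ n ih =>
    rw [← (Fin.consEquiv fun _ : Fin (n + 1) => ι).sum_comp, Fintype.sum_prod_type]
    simp only [Fin.consEquiv_apply, Fin.prod_univ_succ, Fin.sum_univ_succ, Fin.cons_zero,
      Fin.cons_succ]
    -- Expand the square after splitting off the first letter; summed over `i`, the cross term
    -- vanishes because `f` is centred.
    have h : ∀ i : ι, ∑ x : Fin n → ι, p i * (∏ t, p (x t)) * (f i + ∑ t, f (x t)) ^ 2
        = p i * f i ^ 2 + 2 * (p i * f i) * ∑ x : Fin n → ι, (∏ t, p (x t)) * ∑ t, f (x t)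
          + p i * (n * ∑ i, p i * f i ^ 2) := fun i => by
      rw [← ih, ← mul_one (p i * f i ^ 2), ← hone n, Finset.mul_sum, Finset.mul_sum,
        Finset.mul_sum, ← Finset.sum_add_distrib, ← Finset.sum_add_distrib]
      exact Finset.sum_congr rfl fun x _ => by ring
    simp_rw [h]
    rw [Finset.sum_add_distrib, Finset.sum_add_distrib, ← Finset.sum_mul, ← Finset.mul_sum, hf,
      ← Finset.sum_mul, hp]
    push_cast
    ring

variable [DecidableEq ι] (ρ : DensityMatrix ι)

lemma DensityMatrix.eigenvalue_nonneg (i : ι) : 0 ≤ ρ.eigenvalue i :=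
  ρ.posSemidef.eigenvalues_nonneg i

lemma DensityMatrix.sum_eigenvalue : ∑ i, ρ.eigenvalue i = 1 := by
  have h := ρ.posSemidef.isHermitian.trace_eq_sum_eigenvalues
  rw [ρ.trace_eq_one] at h
  have h' : ((∑ i, ρ.eigenvalue i : ℝ) : ℂ) = 1 := by rw [h]; simp [DensityMatrix.eigenvalue]
  exact_mod_cast h'

/-- The eigenvalues of `ρ^{⊗n}`. -/
def DensityMatrix.prodEigenvalue {n : ℕ} (x : Fin n → ι) : ℝ := ∏ t, ρ.eigenvalue (x t)

lemma DensityMatrix.prodEigenvalue_nonneg {n : ℕ} (x : Fin n → ι) : 0 ≤ ρ.prodEigenvalue x :=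
  Finset.prod_nonneg fun _ _ => ρ.eigenvalue_nonneg _

lemma DensityMatrix.sum_prodEigenvalue (n : ℕ) :
    ∑ x : Fin n → ι, ρ.prodEigenvalue x = 1 := by
  simp only [DensityMatrix.prodEigenvalue]
  rw [← Fintype.sum_pow, ρ.sum_eigenvalue, one_pow]

open Classical in
/-- The weight `Tr (Π ρ^{⊗n})` of the typical subspace. -/
def DensityMatrix.typicalWeight (δ : ℝ) (n : ℕ) : ℝ :=
  ∑ x : Fin n → ι, if ρ.IsTypical δ n x then ρ.prodEigenvalue x else 0

/-- Taking logarithms turns the eigenvalue window into a deviation bound for a sum. `h0` excludes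
vanishing eigenvalues, where `Real.logb` takes the default value `0`. -/
lemma DensityMatrix.isTypical_of_abs_sum_le {δ : ℝ} {n : ℕ} {x : Fin n → ι}
    (h0 : ρ.prodEigenvalue x ≠ 0)
    (h : |∑ t, (-Real.logb 2 (ρ.eigenvalue (x t)) - ρ.entropy)| ≤ n * δ) :
    ρ.IsTypical δ n x := by
  have hpos : ∀ t, 0 < ρ.eigenvalue (x t) := fun t =>
    (ρ.eigenvalue_nonneg _).lt_of_ne' (Finset.prod_ne_zero_iff.mp h0 t (Finset.mem_univ t))
  have hprod : ∏ t, ρ.eigenvalue (x t) = (2 : ℝ) ^ (∑ t, Real.logb 2 (ρ.eigenvalue (x t))) := by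
    rw [Real.rpow_sum_of_pos (by norm_num)]
    exact Finset.prod_congr rfl fun t _ =>
      (Real.rpow_logb (by norm_num) (by norm_num) (hpos t)).symm
  rw [Finset.sum_sub_distrib, Finset.sum_neg_distrib, Finset.sum_const, Finset.card_univ,
    Fintype.card_fin, nsmul_eq_mul, abs_le] at h
  rw [DensityMatrix.IsTypical, hprod]
  constructor
  · exact Real.rpow_le_rpow_of_exponent_le (by norm_num) (by linarith [h.2])
  · exact Real.rpow_le_rpow_of_exponent_le (by norm_num) (by linarith [h.1])

/-- Chebyshev's inequality for the typical set. -/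
lemma DensityMatrix.exists_one_sub_typicalWeight_le {δ : ℝ} (hδ : 0 < δ) :
    ∃ C : ℝ, ∀ n : ℕ, 0 < n → 1 - ρ.typicalWeight δ n ≤ C / n := by
  classical
  set f : ι → ℝ := fun i => -Real.logb 2 (ρ.eigenvalue i) - ρ.entropy with hf
  have hf0 : ∑ i, ρ.eigenvalue i * f i = 0 := by
    simp only [hf, mul_sub, Finset.sum_sub_distrib, ← Finset.sum_mul, ρ.sum_eigenvalue, one_mul]
    rw [sub_eq_zero, DensityMatrix.entropy]
    refine Finset.sum_congr rfl fun i _ => ?_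
    simp only [Real.negMulLog, Real.logb]
    ring
  refine ⟨(∑ i, ρ.eigenvalue i * f i ^ 2) / δ ^ 2, fun n hn => ?_⟩
  have hn' : (0 : ℝ) < n := by exact_mod_cast hn
  have hvar := sum_prod_mul_sum_sq ρ.eigenvalue f ρ.sum_eigenvalue hf0 n
  have hle : ∀ x : Fin n → ι, ρ.prodEigenvalue x -
      (if ρ.IsTypical δ n x then ρ.prodEigenvalue x else 0)
      ≤ (ρ.prodEigenvalue x * (∑ t, f (x t)) ^ 2) / (n * δ) ^ 2 := by
    intro x
    have hx := ρ.prodEigenvalue_nonneg x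
    split_ifs with ht
    · rw [sub_self]; positivity
    · rw [sub_zero, le_div_iff₀ (by positivity)]
      -- Sequences of eigenvalue zero carry no weight, so the logarithmic criterion is not needed
      -- for them.
      by_cases h0 : ρ.prodEigenvalue x = 0
      · simp [h0]
      refine mul_le_mul_of_nonneg_left ?_ hx
      have hnot : ¬ |∑ t, f (x t)| ≤ n * δ := fun h => ht (ρ.isTypical_of_abs_sum_le h0 h)
      rw [← sq_abs (∑ t, f (x t))]
      exact pow_le_pow_left₀ (by positivity) (not_le.mp hnot).le 2
  calc 1 - ρ.typicalWeight δ n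
      = ∑ x : Fin n → ι, (ρ.prodEigenvalue x -
          (if ρ.IsTypical δ n x then ρ.prodEigenvalue x else 0)) := by
        rw [Finset.sum_sub_distrib, ρ.sum_prodEigenvalue, DensityMatrix.typicalWeight]
    _ ≤ ∑ x : Fin n → ι, (ρ.prodEigenvalue x * (∑ t, f (x t)) ^ 2) / (n * δ) ^ 2 :=
        Finset.sum_le_sum fun x _ => hle x
    _ = (n * ∑ i, ρ.eigenvalue i * f i ^ 2) / (n * δ) ^ 2 := by
        rw [← Finset.sum_div, ← hvar]; rfl
    _ = _ := by field_simp

lemma DensityMatrix.typicalWeight_le_one (δ : ℝ) (n : ℕ) : ρ.typicalWeight δ n ≤ 1 := by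
  rw [← ρ.sum_prodEigenvalue n]
  refine Finset.sum_le_sum fun x _ => ?_
  split_ifs
  · exact le_rfl
  · exact ρ.prodEigenvalue_nonneg x

lemma DensityMatrix.tendsto_typicalWeight {δ : ℝ} (hδ : 0 < δ) :
    Filter.Tendsto (ρ.typicalWeight δ) Filter.atTop (nhds 1) := by
  obtain ⟨C, hC⟩ := ρ.exists_one_sub_typicalWeight_le hδ
  have h : Filter.Tendsto (fun n : ℕ => 1 - C / n) Filter.atTop (nhds 1) := by
    simpa using (tendsto_const_div_atTop_nhds_zero_nat C).const_sub 1
  refine tendsto_of_tendsto_of_tendsto_of_le_of_le' h tendsto_const_nhds ?_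
    (Filter.Eventually.of_forall fun n => ρ.typicalWeight_le_one δ n)
  filter_upwards [Filter.eventually_gt_atTop 0] with n hn
  linarith [hC n hn]

lemma DensityMatrix.sum_prodEigenvalue_sq (n : ℕ) :
    ∑ x : Fin n → ι, ρ.prodEigenvalue x ^ 2 = (∑ i, ρ.eigenvalue i ^ 2) ^ n := by
  simp only [DensityMatrix.prodEigenvalue, ← Finset.prod_pow]
  exact (Fintype.sum_pow (fun i => ρ.eigenvalue i ^ 2) n).symm

lemma DensityMatrix.eigenvalue_le_one (i : ι) : ρ.eigenvalue i ≤ 1 := by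
  rw [← ρ.sum_eigenvalue]
  exact Finset.single_le_sum (fun j _ => ρ.eigenvalue_nonneg j) (Finset.mem_univ i)

/-- Either the purity is less than one, or the spectrum is `{0, 1}`-valued. -/
lemma DensityMatrix.purity_lt_one_or :
    ∑ i, ρ.eigenvalue i ^ 2 < 1 ∨ ∀ i, ρ.eigenvalue i = 0 ∨ ρ.eigenvalue i = 1 := by
  by_cases h : ∀ i, ρ.eigenvalue i = 0 ∨ ρ.eigenvalue i = 1
  · exact Or.inr h
  left
  push Not at h
  obtain ⟨i, h0, h1⟩ := h
  rw [← ρ.sum_eigenvalue]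
  have hi := ρ.eigenvalue_nonneg
  refine Finset.sum_lt_sum (fun j _ => ?_) ⟨i, Finset.mem_univ i, ?_⟩
  · nlinarith [hi j, ρ.eigenvalue_le_one j]
  · nlinarith [(hi i).lt_of_ne' h0, (ρ.eigenvalue_le_one i).lt_of_ne h1]

end Typical

/-! ### Algebra of tensor powers -/

section TensorPow

variable {ι κ σ : Type*}

lemma prod_sum_eq_sum_prod [Fintype ι] (n : ℕ) (f : Fin n → ι → ℂ) :
    ∏ t, ∑ j, f t j = ∑ z : Fin n → ι, ∏ t, f t (z t) := by
  classical
  rw [Finset.prod_univ_sum, Fintype.piFinset_univ]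

lemma tensorPow_mul [Fintype κ] (M : Matrix ι κ ℂ) (L : Matrix κ σ ℂ) (n : ℕ) :
    tensorPow (M * L) n = tensorPow M n * tensorPow L n := by
  ext x y
  simp only [tensorPow, Matrix.of_apply, Matrix.mul_apply, ← Finset.prod_mul_distrib]
  exact prod_sum_eq_sum_prod n fun t j => M (x t) j * L j (y t)

lemma tensorPow_conjTranspose (M : Matrix ι κ ℂ) (n : ℕ) :
    tensorPow Mᴴ n = (tensorPow M n)ᴴ := by
  ext x y
  simp [tensorPow]

lemma tensorPow_diagonal [DecidableEq ι] (d : ι → ℂ) (n : ℕ) :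
    tensorPow (Matrix.diagonal d) n = Matrix.diagonal fun x => ∏ t, d (x t) := by
  ext x y
  simp only [tensorPow, Matrix.of_apply, Matrix.diagonal_apply]
  split_ifs with h
  · subst h; simp
  · obtain ⟨t, ht⟩ := Function.ne_iff.mp h
    exact Finset.prod_eq_zero (Finset.mem_univ t) (by simp [ht])

lemma tensorPow_one [DecidableEq ι] (n : ℕ) :
    tensorPow (1 : Matrix ι ι ℂ) n = 1 := by
  rw [← Matrix.diagonal_one, tensorPow_diagonal]
  simp

lemma ofReal_sum_norm_sq {m : Type*} [Fintype m] (v : m → ℂ) :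
    ((∑ x, ‖v x‖ ^ 2 : ℝ) : ℂ) = star v ⬝ᵥ v := by
  simp [dotProduct, Complex.conj_mul']

lemma sum_norm_sq_mulVec {m γ : Type*} [Fintype m] [Fintype γ] [DecidableEq m]
    {M : Matrix γ m ℂ} (hM : Mᴴ * M = 1) (w : m → ℂ) :
    ∑ z, ‖(M *ᵥ w) z‖ ^ 2 = ∑ x, ‖w x‖ ^ 2 := by
  apply Complex.ofReal_injective
  rw [ofReal_sum_norm_sq, ofReal_sum_norm_sq, Matrix.star_mulVec, ← Matrix.dotProduct_mulVec, Matrix.mulVec_mulVec, hM,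
    Matrix.one_mulVec]

lemma trace_mul_diagonal_mul_conjTranspose {m γ : Type*} [Fintype m] [Fintype γ] [DecidableEq m]
    (G : Matrix γ m ℂ) (l : m → ℝ) :
    (G * Matrix.diagonal (fun x => (l x : ℂ)) * Gᴴ).trace
      = ((∑ x, l x * ∑ z, ‖G z x‖ ^ 2 : ℝ) : ℂ) := by
  have h : ∀ z, (G * Matrix.diagonal (fun x => (l x : ℂ)) * Gᴴ) z z
      = ∑ x, G z x * (l x : ℂ) * star (G z x) := fun z => by
    rw [Matrix.mul_apply]
    simp only [Matrix.mul_diagonal, Matrix.conjTranspose_apply]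
  simp only [Matrix.trace, Matrix.diag_apply, h]
  rw [Finset.sum_comm]
  push_cast
  refine Finset.sum_congr rfl fun x _ => ?_
  rw [Finset.mul_sum]
  refine Finset.sum_congr rfl fun z _ => ?_
  rw [← Complex.mul_conj']
  simp only [RCLike.star_def]
  ring

end TensorPow

/-! ### Diagonalizing the typical state in the product eigenbasis -/

section TypicalState

variable {ι : Type*} [Fintype ι] [DecidableEq ι] (ρ : DensityMatrix ι)

/-- The product eigenbasis of `ρ^{⊗n}`. -/
def DensityMatrix.prodEigenbasis (n : ℕ) : Matrix (Fin n → ι) (Fin n → ι) ℂ :=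
  tensorPow ρ.eigenbasis n

lemma DensityMatrix.prodEigenbasis_conjTranspose_mul (n : ℕ) :
    (ρ.prodEigenbasis n)ᴴ * ρ.prodEigenbasis n = 1 := by
  rw [DensityMatrix.prodEigenbasis, ← tensorPow_conjTranspose, ← tensorPow_mul,
    DensityMatrix.eigenbasis, ← Matrix.star_eq_conjTranspose, Unitary.coe_star_mul_self,
    tensorPow_one]

/-- The operator with the given eigenvalues in the product eigenbasis of `ρ^{⊗n}`. -/
def DensityMatrix.ofSpectrum {n : ℕ} (l : (Fin n → ι) → ℝ) :
    Matrix (Fin n → ι) (Fin n → ι) ℂ :=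
  ρ.prodEigenbasis n * Matrix.diagonal (fun x => (l x : ℂ)) * (ρ.prodEigenbasis n)ᴴ

lemma DensityMatrix.ofSpectrum_mul {n : ℕ} (l l' : (Fin n → ι) → ℝ) :
    ρ.ofSpectrum l * ρ.ofSpectrum l' = ρ.ofSpectrum fun x => l x * l' x := by
  simp only [DensityMatrix.ofSpectrum]
  calc _ = ρ.prodEigenbasis n * Matrix.diagonal (fun x => (l x : ℂ)) *
        ((ρ.prodEigenbasis n)ᴴ * ρ.prodEigenbasis n) * Matrix.diagonal (fun x => (l' x : ℂ)) *
        (ρ.prodEigenbasis n)ᴴ := by simp only [Matrix.mul_assoc]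
    _ = _ := by
      rw [ρ.prodEigenbasis_conjTranspose_mul, Matrix.mul_one,
        Matrix.mul_assoc (ρ.prodEigenbasis n), Matrix.diagonal_mul_diagonal]
      simp

lemma DensityMatrix.trace_ofSpectrum {n : ℕ} (l : (Fin n → ι) → ℝ) :
    (ρ.ofSpectrum l).trace = ((∑ x, l x : ℝ) : ℂ) := by
  rw [DensityMatrix.ofSpectrum, Matrix.trace_mul_comm, ← Matrix.mul_assoc,
    ρ.prodEigenbasis_conjTranspose_mul, Matrix.one_mul, Matrix.trace_diagonal]
  simp

lemma DensityMatrix.smul_ofSpectrum {n : ℕ} (c : ℝ) (l : (Fin n → ι) → ℝ) :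
    (c : ℂ) • ρ.ofSpectrum l = ρ.ofSpectrum fun x => c * l x := by
  have h : Matrix.diagonal (fun x => ((c * l x : ℝ) : ℂ))
      = (c : ℂ) • Matrix.diagonal (fun x => (l x : ℂ)) := by
    rw [← Matrix.diagonal_smul]; congr 1; ext x; simp
  simp only [DensityMatrix.ofSpectrum, h, Matrix.mul_smul, Matrix.smul_mul]

lemma DensityMatrix.ofSpectrum_conjTranspose {n : ℕ} (l : (Fin n → ι) → ℝ) :
    (ρ.ofSpectrum l)ᴴ = ρ.ofSpectrum l := by
  simp only [DensityMatrix.ofSpectrum, Matrix.conjTranspose_mul, Matrix.conjTranspose_conjTranspose,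
    Matrix.diagonal_conjTranspose, Matrix.mul_assoc]
  congr 3
  ext x
  simp

lemma DensityMatrix.posSemidef_ofSpectrum {n : ℕ} {l : (Fin n → ι) → ℝ} (hl : ∀ x, 0 ≤ l x) :
    (ρ.ofSpectrum l).PosSemidef := by
  refine Matrix.PosSemidef.mul_mul_conjTranspose_same ?_ _
  exact Matrix.PosSemidef.diagonal fun x => Complex.zero_le_real.mpr (hl x)

lemma DensityMatrix.tensorPow_mat (n : ℕ) :
    tensorPow ρ.mat n = ρ.ofSpectrum fun x : Fin n → ι => ρ.prodEigenvalue x := by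
  have h := ρ.posSemidef.isHermitian.spectral_theorem
  rw [Unitary.conjStarAlgAut_apply] at h
  have h' : ρ.mat = ρ.eigenbasis * Matrix.diagonal (fun i => (ρ.eigenvalue i : ℂ)) *
      (ρ.eigenbasis)ᴴ := h
  rw [h', tensorPow_mul, tensorPow_mul, tensorPow_diagonal, tensorPow_conjTranspose]
  simp [DensityMatrix.ofSpectrum, DensityMatrix.prodEigenbasis, DensityMatrix.prodEigenvalue]

open Classical in
lemma DensityMatrix.typicalProj_eq (δ : ℝ) (n : ℕ) :
    ρ.typicalProj δ n = ρ.ofSpectrum fun x => if ρ.IsTypical δ n x then 1 else 0 := by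
  simp only [DensityMatrix.typicalProj, DensityMatrix.ofSpectrum, DensityMatrix.prodEigenbasis]
  congr 3
  ext x
  split_ifs <;> simp

open Classical in
/-- The spectrum of the typical state. -/
def DensityMatrix.typicalSpectrum (δ : ℝ) (n : ℕ) (x : Fin n → ι) : ℝ :=
  if ρ.IsTypical δ n x then (ρ.typicalWeight δ n)⁻¹ * ρ.prodEigenvalue x else 0

lemma DensityMatrix.typicalWeight_nonneg (δ : ℝ) (n : ℕ) : 0 ≤ ρ.typicalWeight δ n :=
  Finset.sum_nonneg fun x _ => by
    split_ifs
    · exact ρ.prodEigenvalue_nonneg x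
    · exact le_rfl

lemma DensityMatrix.typicalSpectrum_nonneg (δ : ℝ) (n : ℕ) (x : Fin n → ι) :
    0 ≤ ρ.typicalSpectrum δ n x := by
  rw [DensityMatrix.typicalSpectrum]
  split_ifs
  · exact mul_nonneg (inv_nonneg.mpr (ρ.typicalWeight_nonneg δ n)) (ρ.prodEigenvalue_nonneg x)
  · exact le_rfl

/-- Projector and tensor power are diagonal in the same basis. No positivity of the weight is
needed: if it vanishes, its inverse is `0` on both sides. -/
lemma DensityMatrix.typicalState_eq (δ : ℝ) (n : ℕ) :
    ρ.typicalState δ n = ρ.ofSpectrum (ρ.typicalSpectrum δ n) := by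
  classical
  rw [DensityMatrix.typicalState, ρ.typicalProj_eq, ρ.tensorPow_mat, ρ.ofSpectrum_mul,
    ρ.ofSpectrum_mul, ρ.trace_ofSpectrum, ← Complex.ofReal_inv, ρ.smul_ofSpectrum]
  congr 1
  ext x
  by_cases hx : ρ.IsTypical δ n x <;>
    simp [DensityMatrix.typicalSpectrum, DensityMatrix.typicalWeight, hx, ← ite_and]

lemma DensityMatrix.sqrt_typicalState (δ : ℝ) (n : ℕ) :
    CFC.sqrt (ρ.typicalState δ n) = ρ.ofSpectrum fun x => √(ρ.typicalSpectrum δ n x) := by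
  refine CFC.sqrt_unique ?_ ?_
  · rw [ρ.ofSpectrum_mul, ρ.typicalState_eq]
    congr 1
    ext x
    exact Real.mul_self_sqrt (ρ.typicalSpectrum_nonneg δ n x)
  · exact Matrix.nonneg_iff_posSemidef.mpr (ρ.posSemidef_ofSpectrum fun x => Real.sqrt_nonneg _)

lemma DensityMatrix.sum_typicalSpectrum {δ : ℝ} {n : ℕ} (h : 0 < ρ.typicalWeight δ n) :
    ∑ x, ρ.typicalSpectrum δ n x = 1 := by
  classical
  have : ∀ x, ρ.typicalSpectrum δ n x
      = (ρ.typicalWeight δ n)⁻¹ * if ρ.IsTypical δ n x then ρ.prodEigenvalue x else 0 := fun x => by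
    simp [DensityMatrix.typicalSpectrum]
  simp_rw [this]
  rw [← Finset.mul_sum]
  exact inv_mul_cancel₀ h.ne'

lemma DensityMatrix.typicalSpectrum_le (δ : ℝ) (n : ℕ) (x : Fin n → ι) :
    ρ.typicalSpectrum δ n x ≤ (ρ.typicalWeight δ n)⁻¹ * ρ.prodEigenvalue x := by
  rw [DensityMatrix.typicalSpectrum]
  split_ifs
  · exact le_rfl
  · exact mul_nonneg (inv_nonneg.mpr (ρ.typicalWeight_nonneg δ n)) (ρ.prodEigenvalue_nonneg x)

/-- The column of the product eigenbasis indexed by `x`. -/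
def DensityMatrix.eigenvec {n : ℕ} (x : Fin n → ι) : EuclideanSpace ℂ (Fin n → ι) :=
  WithLp.toLp 2 fun y => ρ.prodEigenbasis n y x

lemma DensityMatrix.inner_eigenvec {n : ℕ} (x : Fin n → ι) (v : EuclideanSpace ℂ (Fin n → ι)) :
    inner ℂ (ρ.eigenvec x) v = ((ρ.prodEigenbasis n)ᴴ *ᵥ v.ofLp) x := by
  simp [DensityMatrix.eigenvec, PiLp.inner_apply, Matrix.mulVec, dotProduct, mul_comm]

lemma DensityMatrix.orthonormal_eigenvec (n : ℕ) :
    Orthonormal ℂ (fun x : Fin n → ι => ρ.eigenvec x) := by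
  rw [orthonormal_iff_ite]
  intro x y
  rw [ρ.inner_eigenvec]
  have h := congrFun (congrFun (ρ.prodEigenbasis_conjTranspose_mul n) x) y
  rw [Matrix.one_apply] at h
  exact h

lemma DensityMatrix.ofSpectrum_mulVec {n : ℕ} (l : (Fin n → ι) → ℝ) (v : (Fin n → ι) → ℂ) :
    ρ.ofSpectrum l *ᵥ v
      = ρ.prodEigenbasis n *ᵥ fun x => (l x : ℂ) * ((ρ.prodEigenbasis n)ᴴ *ᵥ v) x := by
  rw [DensityMatrix.ofSpectrum, ← Matrix.mulVec_mulVec, ← Matrix.mulVec_mulVec]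
  congr 1
  ext x
  rw [Matrix.mulVec_diagonal]

lemma DensityMatrix.ofSpectrum_mulVec_eigenvec {n : ℕ} (l : (Fin n → ι) → ℝ) (x : Fin n → ι) :
    ρ.ofSpectrum l *ᵥ (ρ.eigenvec x).ofLp = (l x : ℂ) • (ρ.eigenvec x).ofLp := by
  have h : (ρ.prodEigenbasis n)ᴴ *ᵥ (ρ.eigenvec x).ofLp = Pi.single x 1 := by
    ext y
    rw [← ρ.inner_eigenvec, orthonormal_iff_ite.mp (ρ.orthonormal_eigenvec n), Pi.single_apply]
  rw [ρ.ofSpectrum_mulVec, h]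
  have h2 : (fun y => (l y : ℂ) * (Pi.single x 1 : (Fin n → ι) → ℂ) y) = Pi.single x (l x : ℂ) := by
    ext y
    by_cases hy : y = x
    · subst hy; simp
    · simp [hy]
  rw [h2, Matrix.mulVec_single]
  ext y
  simp [DensityMatrix.eigenvec, Matrix.col, mul_comm]

lemma DensityMatrix.eigenvec_mem_typicalSubspace {δ : ℝ} {n : ℕ} {x : Fin n → ι}
    (hx : ρ.IsTypical δ n x) : ρ.eigenvec x ∈ ρ.typicalSubspace δ n := by
  classical
  refine ⟨ρ.eigenvec x, ?_⟩
  rw [Matrix.toLpLin_apply, ρ.typicalProj_eq, ρ.ofSpectrum_mulVec_eigenvec]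
  simp [hx]

lemma DensityMatrix.sum_typical {M : Type*} [AddCommMonoid M] {δ : ℝ} {n : ℕ}
    [Fintype {x : Fin n → ι // ρ.IsTypical δ n x}] (g : (Fin n → ι) → M)
    (hg : ∀ x, ¬ ρ.IsTypical δ n x → g x = 0) :
    ∑ x : {x : Fin n → ι // ρ.IsTypical δ n x}, g x = ∑ x, g x := by
  classical
  rw [← Finset.sum_subtype (Finset.univ.filter fun x => ρ.IsTypical δ n x) (by simp) g,
    Finset.sum_filter]
  refine Finset.sum_congr rfl fun x _ => ?_
  split_ifs with h
  · rfl
  · exact (hg x h).symm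

/-- This basis diagonalizes the typical state on its own support, which lets the sphere moments for
diagonal forms apply to codewords. -/
lemma DensityMatrix.exists_typicalBasis (δ : ℝ) (n : ℕ)
    [Fintype {x : Fin n → ι // ρ.IsTypical δ n x}] :
    ∃ b : OrthonormalBasis {x : Fin n → ι // ρ.IsTypical δ n x} ℂ (ρ.typicalSubspace δ n),
      ∀ x, (b x : EuclideanSpace ℂ (Fin n → ι)) = ρ.eigenvec (x : Fin n → ι) := by
  classical
  let v : {x : Fin n → ι // ρ.IsTypical δ n x} → ρ.typicalSubspace δ n :=
    fun x => ⟨ρ.eigenvec (x : Fin n → ι), ρ.eigenvec_mem_typicalSubspace x.2⟩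
  have hv : Orthonormal ℂ v := by
    have h := (ρ.orthonormal_eigenvec n).comp
      (fun x : {x : Fin n → ι // ρ.IsTypical δ n x} => (x : Fin n → ι)) Subtype.val_injective
    rw [orthonormal_iff_ite] at h ⊢
    exact h
  have hspan : ⊤ ≤ Submodule.span ℂ (Set.range v) := by
    rintro ⟨_, w, rfl⟩ -
    have h : (⟨Matrix.toEuclideanLin (ρ.typicalProj δ n) w, w, rfl⟩ : ρ.typicalSubspace δ n)
        = ∑ x : {x : Fin n → ι // ρ.IsTypical δ n x},
            ((ρ.prodEigenbasis n)ᴴ *ᵥ w.ofLp) (x : Fin n → ι) • v x := by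
      apply Subtype.ext
      rw [AddSubmonoidClass.coe_finsetSum]
      ext y
      simp only [Matrix.toLpLin_apply, ρ.typicalProj_eq, ρ.ofSpectrum_mulVec, v,
        Submodule.coe_smul, WithLp.ofLp_sum, Finset.sum_apply, PiLp.smul_apply,
        DensityMatrix.eigenvec, smul_eq_mul]
      rw [Matrix.mulVec, dotProduct, ← ρ.sum_typical (δ := δ)]
      · refine Finset.sum_congr rfl fun x _ => ?_
        simp [x.2, mul_comm]
      · intro x hx
        simp [hx]
    rw [h]
    exact Submodule.sum_mem _ fun x _ =>
      Submodule.smul_mem _ _ (Submodule.subset_span (Set.mem_range_self x))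
  exact ⟨OrthonormalBasis.mk hv hspan, fun x => by rw [OrthonormalBasis.coe_mk]⟩

end TypicalState

/-! ### Moments of a random codeword -/

section Codeword

variable {ι : Type*} [Fintype ι] [DecidableEq ι] (ρ : DensityMatrix ι)

lemma codeword_eq (δ : ℝ) (n : ℕ) (φ : Metric.sphere (0 : ρ.typicalSubspace δ n) 1) :
    codeword ρ δ n φ = (√(Module.finrank ℂ (ρ.typicalSubspace δ n)) : ℂ) •
      (ρ.ofSpectrum (fun x => √(ρ.typicalSpectrum δ n x)) *ᵥ
        ((φ : ρ.typicalSubspace δ n) : EuclideanSpace ℂ (Fin n → ι)).ofLp) := by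
  rw [codeword, ρ.sqrt_typicalState]

/-- The product eigenbasis is unitary, so the square root of the typical state contributes its
eigenvalues. The result is a diagonal form of trace one times the dimension, as needed for
`integral_quadraticForm_sub_one_sq_le`. -/
lemma sum_norm_sq_codeword {δ : ℝ} {n : ℕ} [Fintype {x : Fin n → ι // ρ.IsTypical δ n x}]
    (b : OrthonormalBasis {x : Fin n → ι // ρ.IsTypical δ n x} ℂ (ρ.typicalSubspace δ n))
    (hb : ∀ x, (b x : EuclideanSpace ℂ (Fin n → ι)) = ρ.eigenvec (x : Fin n → ι))
    (φ : Metric.sphere (0 : ρ.typicalSubspace δ n) 1) :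
    ∑ x, ‖codeword ρ δ n φ x‖ ^ 2 = Module.finrank ℂ (ρ.typicalSubspace δ n) *
      ∑ x : {x : Fin n → ι // ρ.IsTypical δ n x}, ρ.typicalSpectrum δ n x *
        ‖inner ℂ (b x) (φ : ρ.typicalSubspace δ n)‖ ^ 2 := by
  classical
  have h1 : ∀ x : {x : Fin n → ι // ρ.IsTypical δ n x},
      inner ℂ (b x) (φ : ρ.typicalSubspace δ n) = ((ρ.prodEigenbasis n)ᴴ *ᵥ
        ((φ : ρ.typicalSubspace δ n) : EuclideanSpace ℂ (Fin n → ι)).ofLp) x := fun x => by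
    rw [← ρ.inner_eigenvec, ← hb]
    rfl
  simp_rw [h1]
  rw [ρ.sum_typical (fun x => ρ.typicalSpectrum δ n x * ‖((ρ.prodEigenbasis n)ᴴ *ᵥ
        ((φ : ρ.typicalSubspace δ n) : EuclideanSpace ℂ (Fin n → ι)).ofLp) x‖ ^ 2)
      fun x hx => by simp [DensityMatrix.typicalSpectrum, hx], codeword_eq,
    ρ.ofSpectrum_mulVec]
  simp only [Pi.smul_apply, norm_smul, mul_pow]
  rw [← Finset.mul_sum, sum_norm_sq_mulVec (ρ.prodEigenbasis_conjTranspose_mul n)]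
  congr 1
  · simp
  · refine Finset.sum_congr rfl fun x _ => ?_
    rw [norm_mul, mul_pow, Complex.norm_real, Real.norm_eq_abs, sq_abs,
      Real.sq_sqrt (ρ.typicalSpectrum_nonneg δ n x)]

lemma continuous_codeword (δ : ℝ) (n : ℕ) : Continuous (codeword ρ δ n) := by
  unfold codeword
  fun_prop

lemma nontrivial_typicalSubspace {δ : ℝ} {n : ℕ} (h : 0 < ρ.typicalWeight δ n) :
    Nontrivial (ρ.typicalSubspace δ n) := by
  classical
  obtain ⟨x, -, hx⟩ := Finset.exists_ne_zero_of_sum_ne_zero h.ne'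
  have ht : ρ.IsTypical δ n x := by
    by_contra ht
    simp [ht] at hx
  refine ⟨⟨⟨_, ρ.eigenvec_mem_typicalSubspace ht⟩, 0, fun h0 => ?_⟩⟩
  have h1 : ‖ρ.eigenvec x‖ = 1 := (ρ.orthonormal_eigenvec n).1 x
  rw [show ρ.eigenvec x = 0 from congrArg Subtype.val h0, norm_zero] at h1
  exact zero_ne_one h1

/-- Concentration of the squared norm of a random codeword. -/
lemma integral_codeword_norm_sq_sub_one_sq_le {δ : ℝ} {n : ℕ} (h : 0 < ρ.typicalWeight δ n) :
    ∫ φ, (∑ x, ‖codeword ρ δ n φ x‖ ^ 2 - 1) ^ 2 ∂uniformSphere (ρ.typicalSubspace δ n)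
      ≤ (∑ i, ρ.eigenvalue i ^ 2) ^ n / ρ.typicalWeight δ n ^ 2 := by
  classical
  have := nontrivial_typicalSubspace ρ h
  obtain ⟨b, hb⟩ := ρ.exists_typicalBasis δ n
  simp_rw [sum_norm_sq_codeword ρ b hb]
  have hsum := ρ.sum_typical (δ := δ) (fun x : Fin n → ι => ρ.typicalSpectrum δ n x)
    fun x hx => by simp [DensityMatrix.typicalSpectrum, hx]
  rw [ρ.sum_typicalSpectrum h] at hsum
  refine (integral_quadraticForm_sub_one_sq_le b
    (fun x => ρ.typicalSpectrum δ n x) hsum).trans ?_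
  rw [ρ.sum_typical (δ := δ) (fun x : Fin n → ι => ρ.typicalSpectrum δ n x ^ 2)
    fun x hx => by simp [DensityMatrix.typicalSpectrum, hx], ← ρ.sum_prodEigenvalue_sq,
    Finset.sum_div]
  refine Finset.sum_le_sum fun x _ => ?_
  refine (pow_le_pow_left₀ (ρ.typicalSpectrum_nonneg δ n x)
    (ρ.typicalSpectrum_le δ n x) 2).trans (le_of_eq ?_)
  rw [mul_pow, inv_pow, div_eq_inv_mul]

/-- For a source with `{0, 1}`-valued spectrum the codewords are normalized. -/
lemma integral_codeword_norm_sq_sub_one_sq_eq_zero {δ : ℝ} {n : ℕ}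
    (h : 0 < ρ.typicalWeight δ n) (hρ : ∀ i, ρ.eigenvalue i = 0 ∨ ρ.eigenvalue i = 1) :
    ∫ φ, (∑ x, ‖codeword ρ δ n φ x‖ ^ 2 - 1) ^ 2 ∂uniformSphere (ρ.typicalSubspace δ n) = 0 := by
  classical
  have := nontrivial_typicalSubspace ρ h
  obtain ⟨b, hb⟩ := ρ.exists_typicalBasis δ n
  have hcard : Fintype.card {x : Fin n → ι // ρ.IsTypical δ n x}
      = Module.finrank ℂ (ρ.typicalSubspace δ n) :=
    (Module.finrank_eq_card_basis b.toBasis).symm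
  -- A typical sequence has a positive eigenvalue, so all its factors equal `1` and the typical
  -- spectrum is flat; the codeword norm is then constant on the sphere.
  have hp : ∀ x : {x : Fin n → ι // ρ.IsTypical δ n x},
      ρ.typicalSpectrum δ n x = (ρ.typicalWeight δ n)⁻¹ := by
    rintro ⟨x, hx⟩
    have h1 : ρ.prodEigenvalue x = 1 := by
      have hpos : 0 < ρ.prodEigenvalue x := (Real.rpow_pos_of_pos (by norm_num) _).trans_le hx.1
      exact Finset.prod_eq_one fun t _ =>
        (hρ (x t)).resolve_left (Finset.prod_ne_zero_iff.mp hpos.ne' t (Finset.mem_univ t))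
    simp [DensityMatrix.typicalSpectrum, hx, h1]
  have hsum := ρ.sum_typical (δ := δ) (fun x : Fin n → ι => ρ.typicalSpectrum δ n x)
    fun x hx => by simp [DensityMatrix.typicalSpectrum, hx]
  rw [ρ.sum_typicalSpectrum h, Finset.sum_congr rfl fun x _ => hp x, Finset.sum_const,
    Finset.card_univ, hcard, nsmul_eq_mul] at hsum
  have h0 : ∀ φ : Metric.sphere (0 : ρ.typicalSubspace δ n) 1,
      (∑ x, ‖codeword ρ δ n φ x‖ ^ 2 - 1) ^ 2 = 0 := fun φ => by
    rw [sum_norm_sq_codeword ρ b hb]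
    simp_rw [hp]
    rw [← Finset.mul_sum, b.sum_sq_norm_inner_right, ← mul_assoc, hsum]
    simp
  simp_rw [h0]
  simp

/-- The mean of `‖R c‖ ^ 2` over random codewords `c` is controlled by `Tr (R ρ^{⊗n} Rᴴ)`. -/
lemma integral_mulVec_codeword_le {γ : Type*} [Fintype γ] {δ : ℝ} {n : ℕ}
    (h : 0 < ρ.typicalWeight δ n) (R : Matrix γ (Fin n → ι) ℂ) :
    ∫ φ, ∑ z, ‖(R *ᵥ codeword ρ δ n φ) z‖ ^ 2 ∂uniformSphere (ρ.typicalSubspace δ n)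
      ≤ (R * tensorPow ρ.mat n * Rᴴ).trace.re / ρ.typicalWeight δ n := by
  classical
  have := nontrivial_typicalSubspace ρ h
  obtain ⟨b, hb⟩ := ρ.exists_typicalBasis δ n
  have hd : (Module.finrank ℂ (ρ.typicalSubspace δ n) : ℝ) ≠ 0 := by
    exact_mod_cast Module.finrank_pos.ne'
  set d := Module.finrank ℂ (ρ.typicalSubspace δ n) with hdef
  -- The codeword is linear in `φ`; the factor `√d` in it compensates the `1 / d` in the sphere
  -- average.
  let T : ρ.typicalSubspace δ n →ₗ[ℂ] EuclideanSpace ℂ γ :=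
    ((√d : ℂ) • Matrix.toEuclideanLin
      (R * ρ.ofSpectrum fun x : Fin n → ι => √(ρ.typicalSpectrum δ n x))) ∘ₗ
        (ρ.typicalSubspace δ n).subtype
  have hT : ∀ φ : Metric.sphere (0 : ρ.typicalSubspace δ n) 1,
      ∑ z, ‖(R *ᵥ codeword ρ δ n φ) z‖ ^ 2 = ‖T φ‖ ^ 2 := fun φ => by
    rw [EuclideanSpace.norm_sq_eq, codeword_eq, Matrix.mulVec_smul, Matrix.mulVec_mulVec]
    rfl
  have hTb : ∀ x, ‖T (b x)‖ ^ 2 = d * (ρ.typicalSpectrum δ n x *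
      ∑ z, ‖(R * ρ.prodEigenbasis n) z x‖ ^ 2) := fun x => by
    have : T (b x) = (√d : ℂ) • (√(ρ.typicalSpectrum δ n x) : ℂ) •
        WithLp.toLp 2 (R *ᵥ (ρ.eigenvec (x : Fin n → ι)).ofLp) := by
      simp only [T, LinearMap.comp_apply, LinearMap.smul_apply, Submodule.subtype_apply, hb,
        Matrix.toLpLin_apply]
      rw [← Matrix.mulVec_mulVec, ρ.ofSpectrum_mulVec_eigenvec, Matrix.mulVec_smul]
      rfl
    rw [this, norm_smul, norm_smul, mul_pow, mul_pow, EuclideanSpace.norm_sq_eq]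
    simp only [Complex.norm_real, Real.norm_eq_abs, sq_abs]
    rw [Real.sq_sqrt (by positivity), Real.sq_sqrt (ρ.typicalSpectrum_nonneg δ n x)]
    rfl
  simp_rw [hT]
  rw [integral_norm_map_sq b T]
  simp_rw [hTb]
  rw [← Finset.mul_sum, ← hdef, mul_div_cancel_left₀ _ hd,
    ρ.sum_typical (δ := δ) (fun x : Fin n → ι => ρ.typicalSpectrum δ n x *
      ∑ z, ‖(R * ρ.prodEigenbasis n) z x‖ ^ 2)
    fun x hx => by simp [DensityMatrix.typicalSpectrum, hx]]
  have htr : (R * tensorPow ρ.mat n * Rᴴ).trace.re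
      = ∑ x, ρ.prodEigenvalue x * ∑ z, ‖(R * ρ.prodEigenbasis n) z x‖ ^ 2 := by
    have := trace_mul_diagonal_mul_conjTranspose (R * ρ.prodEigenbasis n)
      (fun x : Fin n → ι => ρ.prodEigenvalue x)
    rw [← Complex.ofReal_re (∑ x, _), ← this, ρ.tensorPow_mat, DensityMatrix.ofSpectrum,
      Matrix.conjTranspose_mul]
    simp only [Matrix.mul_assoc]
  rw [htr, div_eq_inv_mul, Finset.mul_sum]
  refine Finset.sum_le_sum fun x _ => ?_
  rw [← mul_assoc]
  exact mul_le_mul_of_nonneg_right (ρ.typicalSpectrum_le δ n x)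
    (Finset.sum_nonneg fun _ _ => sq_nonneg _)

end Codeword

/-! ### Stinespring isometry, joint output and its marginals -/

section ChannelPow

variable {ι β κ : Type*} [Fintype ι] [Fintype β] [Fintype κ] [DecidableEq ι]
  (Λ : Channel ι β κ) (ρ : DensityMatrix ι)

/-- The Stinespring isometry of the channel. -/
def Channel.stinespring : Matrix (β × κ) ι ℂ := Matrix.of fun z i => Λ.kraus z.2 z.1 i

/-- The Stinespring isometry of the `n`-fold tensor power of the channel. -/
def Channel.stinespringPow (n : ℕ) : Matrix ((Fin n → β) × (Fin n → κ)) (Fin n → ι) ℂ :=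
  Matrix.of fun z x => tensorKraus Λ.kraus n z.2 z.1 x

lemma Channel.stinespring_conjTranspose_mul : (Λ.stinespring)ᴴ * Λ.stinespring = 1 := by
  rw [← Λ.sum_conjTranspose_mul]
  ext i j
  rw [Matrix.mul_apply, Fintype.sum_prod_type, Finset.sum_comm, Matrix.sum_apply]
  simp only [Matrix.mul_apply]
  rfl

/-- Up to regrouping the `n` receiver-environment pairs this is an ordinary tensor power, so the
isometry property is inherited from one copy. -/
lemma Channel.stinespringPow_eq (n : ℕ) :
    Λ.stinespringPow n = (tensorPow Λ.stinespring n).submatrix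
      (Equiv.arrowProdEquivProdArrow (Fin n) (fun _ => β) (fun _ => κ)).symm id := rfl

lemma Channel.stinespringPow_conjTranspose_mul (n : ℕ) :
    (Λ.stinespringPow n)ᴴ * Λ.stinespringPow n = 1 := by
  rw [Λ.stinespringPow_eq, Matrix.conjTranspose_submatrix, Matrix.submatrix_mul_equiv,
    Matrix.submatrix_id_id, ← tensorPow_conjTranspose, ← tensorPow_mul,
    Λ.stinespring_conjTranspose_mul, tensorPow_one]

/-- The joint output of receiver and environment. -/
def Channel.jointOutput (n : ℕ) :
    Matrix ((Fin n → β) × (Fin n → κ)) ((Fin n → β) × (Fin n → κ)) ℂ :=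
  Λ.stinespringPow n * tensorPow ρ.mat n * (Λ.stinespringPow n)ᴴ

lemma Channel.jointOutput_apply (n : ℕ) (y y' : Fin n → β) (k k' : Fin n → κ) :
    Λ.jointOutput ρ n (y, k) (y', k')
      = ∏ t, (Λ.kraus (k t) * ρ.mat * (Λ.kraus (k' t))ᴴ) (y t) (y' t) := by
  have h : Λ.jointOutput ρ n = (tensorPow (Λ.stinespring * ρ.mat * (Λ.stinespring)ᴴ) n).submatrix
      (Equiv.arrowProdEquivProdArrow (Fin n) (fun _ => β) (fun _ => κ)).symm
      (Equiv.arrowProdEquivProdArrow (Fin n) (fun _ => β) (fun _ => κ)).symm := by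
    rw [tensorPow_mul, tensorPow_mul, tensorPow_conjTranspose]
    rfl
  rw [h]
  rfl

/-- The partial trace over the environment acts copy by copy, because a sum over sequences of a
product is the product of the letterwise sums. -/
lemma Channel.sum_jointOutput_env (n : ℕ) (y y' : Fin n → β) :
    ∑ k, Λ.jointOutput ρ n (y, k) (y', k) = tensorPow (Λ.receiver ρ).mat n y y' := by
  simp only [Λ.jointOutput_apply, tensorPow, Matrix.of_apply, Channel.receiver, Matrix.sum_apply]
  exact (prod_sum_eq_sum_prod n fun t k =>
    (Λ.kraus k * ρ.mat * (Λ.kraus k)ᴴ) (y t) (y' t)).symm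

lemma Channel.sum_jointOutput_receiver (n : ℕ) (k k' : Fin n → κ) :
    ∑ y, Λ.jointOutput ρ n (y, k) (y, k') = tensorPow (Λ.environment ρ).mat n k k' := by
  simp only [Λ.jointOutput_apply, tensorPow, Matrix.of_apply, Channel.environment]
  exact (prod_sum_eq_sum_prod n fun t y =>
    (Λ.kraus (k t) * ρ.mat * (Λ.kraus (k' t))ᴴ) y y).symm

lemma Channel.posSemidef_jointOutput (n : ℕ) : (Λ.jointOutput ρ n).PosSemidef := by
  rw [Channel.jointOutput, ρ.tensorPow_mat]
  exact (ρ.posSemidef_ofSpectrum fun x => ρ.prodEigenvalue_nonneg x).mul_mul_conjTranspose_same _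

variable [DecidableEq β] [DecidableEq κ]

/-- The hypothesis `hZ` says that `Z` is the partial trace of `Y`, so an observable on one factor
only sees that marginal. -/
lemma trace_kronecker_one_mul {m l : Type*} [Fintype m] [Fintype l] [DecidableEq l]
    (M : Matrix m m ℂ) (Y : Matrix (m × l) (m × l) ℂ) (Z : Matrix m m ℂ)
    (hZ : ∀ y y', ∑ k, Y (y, k) (y', k) = Z y y') :
    ((M ⊗ₖ (1 : Matrix l l ℂ)) * Y).trace = (M * Z).trace := by
  simp only [Matrix.trace, Matrix.diag_apply, Matrix.mul_apply, Fintype.sum_prod_type,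
    Matrix.kroneckerMap_apply, Matrix.one_apply, mul_ite, mul_one, mul_zero, ite_mul, zero_mul,
    Finset.sum_ite_eq, Finset.mem_univ, if_true, ← hZ, Finset.mul_sum]
  exact Finset.sum_congr rfl fun y _ => Finset.sum_comm

lemma trace_one_kronecker_mul {m l : Type*} [Fintype m] [Fintype l] [DecidableEq m]
    (M : Matrix l l ℂ) (Y : Matrix (m × l) (m × l) ℂ) (Z : Matrix l l ℂ)
    (hZ : ∀ k k', ∑ y, Y (y, k) (y, k') = Z k k') :
    (((1 : Matrix m m ℂ) ⊗ₖ M) * Y).trace = (M * Z).trace := by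
  have h : ∀ (y : m) (k : l), ∑ y' : m, ∑ k' : l, (if y = y' then M k k' * Y (y', k') (y, k) else 0)
      = ∑ k', M k k' * Y (y, k') (y, k) := fun y k => by
    rw [Finset.sum_comm]
    simp
  simp only [Matrix.trace, Matrix.diag_apply, Matrix.mul_apply, Fintype.sum_prod_type,
    Matrix.kroneckerMap_apply, Matrix.one_apply, ite_mul, one_mul, zero_mul, h, ← hZ,
    Finset.mul_sum]
  rw [Finset.sum_comm]
  exact Finset.sum_congr rfl fun y _ => Finset.sum_comm

lemma DensityMatrix.trace_one_sub_typicalProj_mul (δ : ℝ) (n : ℕ) :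
    ((1 - ρ.typicalProj δ n) * tensorPow ρ.mat n).trace
      = ((1 - ρ.typicalWeight δ n : ℝ) : ℂ) := by
  classical
  rw [Matrix.sub_mul, Matrix.one_mul, Matrix.trace_sub, ρ.typicalProj_eq, ρ.tensorPow_mat,
    ρ.ofSpectrum_mul, ρ.trace_ofSpectrum, ρ.trace_ofSpectrum, ρ.sum_prodEigenvalue,
    DensityMatrix.typicalWeight, ← Complex.ofReal_sub]
  simp

lemma DensityMatrix.typicalProj_mul_self (δ : ℝ) (n : ℕ) :
    ρ.typicalProj δ n * ρ.typicalProj δ n = ρ.typicalProj δ n := by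
  classical
  rw [ρ.typicalProj_eq, ρ.ofSpectrum_mul]
  congr 1
  ext x
  simp

lemma DensityMatrix.typicalProj_conjTranspose (δ : ℝ) (n : ℕ) :
    (ρ.typicalProj δ n)ᴴ = ρ.typicalProj δ n := by
  classical
  rw [ρ.typicalProj_eq, ρ.ofSpectrum_conjTranspose]

/-- Projecting onto the typical subspaces of receiver and environment loses little weight. -/
lemma trace_one_sub_kronecker_le {m l : Type*} [Fintype m] [Fintype l] [DecidableEq m]
    [DecidableEq l] {P : Matrix m m ℂ} {Q : Matrix l l ℂ} (hP : P * P = P) (hPh : Pᴴ = P)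
    (hQ : Q * Q = Q) (hQh : Qᴴ = Q) {Y : Matrix (m × l) (m × l) ℂ} (hY : Y.PosSemidef) :
    ((1 - P ⊗ₖ Q) * Y * (1 - P ⊗ₖ Q)ᴴ).trace.re
      ≤ (((1 - P) ⊗ₖ (1 : Matrix l l ℂ)) * Y).trace.re
        + (((1 : Matrix m m ℂ) ⊗ₖ (1 - Q)) * Y).trace.re := by
  have hK : (P ⊗ₖ Q) * (P ⊗ₖ Q) = P ⊗ₖ Q := by rw [← Matrix.mul_kronecker_mul, hP, hQ]
  have hKh : (P ⊗ₖ Q)ᴴ = P ⊗ₖ Q := by rw [Matrix.conjTranspose_kronecker, hPh, hQh]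
  have h1 : ((1 - P ⊗ₖ Q) * Y * (1 - P ⊗ₖ Q)ᴴ).trace = ((1 - P ⊗ₖ Q) * Y).trace := by
    rw [Matrix.trace_mul_comm, ← Matrix.mul_assoc, Matrix.conjTranspose_sub, hKh,
      Matrix.conjTranspose_one]
    congr 2
    rw [sub_mul, mul_sub, mul_sub, hK]
    simp
  set L := (1 - P) ⊗ₖ (1 - Q) with hL
  have hLL : L * L = L := by
    rw [hL, ← Matrix.mul_kronecker_mul]
    congr 1
    · rw [sub_mul, mul_sub, mul_sub, hP]; simp
    · rw [sub_mul, mul_sub, mul_sub, hQ]; simp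
  have hLh : Lᴴ = L := by
    rw [hL, Matrix.conjTranspose_kronecker, Matrix.conjTranspose_sub, Matrix.conjTranspose_sub,
      hPh, hQh, Matrix.conjTranspose_one, Matrix.conjTranspose_one]
  have h2 : 0 ≤ (L * Y).trace.re := by
    have h := (hY.mul_mul_conjTranspose_same L).trace_nonneg
    rw [Matrix.trace_mul_comm, ← Matrix.mul_assoc, hLh, hLL] at h
    exact (Complex.nonneg_iff.mp h).1
  -- Inclusion-exclusion for commuting projectors; the overlap `L` is itself a projector, so
  -- dropping it only increases the trace against `Y`.
  have h3 : (1 : Matrix (m × l) (m × l) ℂ) - P ⊗ₖ Q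
      = (1 - P) ⊗ₖ (1 : Matrix l l ℂ) + (1 : Matrix m m ℂ) ⊗ₖ (1 - Q) - L := by
    ext ⟨i, j⟩ ⟨i', j'⟩
    simp only [hL, Matrix.sub_apply, Matrix.add_apply, Matrix.kroneckerMap_apply,
      Matrix.one_apply, Prod.mk.injEq, ite_and]
    split_ifs <;> ring
  rw [h1, h3, Matrix.sub_mul, Matrix.add_mul, Matrix.trace_sub, Matrix.trace_add, Complex.sub_re,
    Complex.add_re]
  linarith

end ChannelPow

/-! ### Superpositions labelled by an orthonormal family -/

section TensorSum

variable {a m : Type*} [Fintype a] [Fintype m] {N : ℕ}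

/-- The vector `∑ α, ψ α ⊗ w α`. -/
def tensorSum (ψ : Fin N → EuclideanSpace ℂ a) (w : Fin N → m → ℂ) : a × m → ℂ :=
  fun z => ∑ α, ψ α z.1 * w α z.2

/-- Pythagoras for each fixed `z`: orthonormality removes the cross terms between codewords. This
reduces the joint state to averages over single codewords. -/
lemma norm_sq_tensorSum {ψ : Fin N → EuclideanSpace ℂ a} (hψ : Orthonormal ℂ ψ)
    (w : Fin N → m → ℂ) :
    ‖WithLp.toLp 2 (tensorSum ψ w)‖ ^ 2 = ∑ α, ∑ z, ‖w α z‖ ^ 2 := by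
  have h : ∀ z : m, ∑ i : a, ‖tensorSum ψ w (i, z)‖ ^ 2 = ∑ α, ‖w α z‖ ^ 2 := fun z => by
    have h1 : ∑ i : a, ‖tensorSum ψ w (i, z)‖ ^ 2 = ‖∑ α, w α z • ψ α‖ ^ 2 := by
      rw [EuclideanSpace.norm_sq_eq]
      simp [tensorSum, mul_comm]
    have h2 := hψ.inner_sum (fun α => w α z) (fun α => w α z) Finset.univ
    rw [inner_self_eq_norm_sq_to_K] at h2
    rw [h1]
    apply Complex.ofReal_injective
    push_cast
    refine Eq.trans h2 (Finset.sum_congr rfl fun α _ => ?_)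
    exact Complex.conj_mul' _
  rw [EuclideanSpace.norm_sq_eq, Fintype.sum_prod_type_right]
  simp only [h]
  exact Finset.sum_comm

lemma one_kronecker_mulVec_tensorSum [DecidableEq a] (K : Matrix m m ℂ)
    (ψ : Fin N → EuclideanSpace ℂ a) (w : Fin N → m → ℂ) :
    ((1 : Matrix a a ℂ) ⊗ₖ K) *ᵥ tensorSum ψ w = tensorSum ψ fun α => K *ᵥ w α := by
  ext ⟨i, z⟩
  simp only [Matrix.mulVec, dotProduct, tensorSum, Fintype.sum_prod_type,
    Matrix.kroneckerMap_apply, Matrix.one_apply, ite_mul, one_mul, zero_mul]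
  rw [Finset.sum_comm]
  simp only [Finset.sum_ite_eq, Finset.mem_univ, if_true, Finset.mul_sum]
  rw [Finset.sum_comm]
  exact Finset.sum_congr rfl fun α _ => Finset.sum_congr rfl fun z' _ => by ring

end TensorSum

/-! ### The defect: its mean, and its control of the trace norm -/

section Defect

variable {ι β κ : Type*} [Fintype ι] [Fintype β] [Fintype κ]
    [DecidableEq ι] [DecidableEq β] [DecidableEq κ] (ρ : DensityMatrix ι) (Λ : Channel ι β κ)

/-- The product of the typical projectors of receiver and environment. -/
def outputProj (δ : ℝ) (n : ℕ) :
    Matrix ((Fin n → β) × (Fin n → κ)) ((Fin n → β) × (Fin n → κ)) ℂ :=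
  (Λ.receiver ρ).typicalProj δ n ⊗ₖ (Λ.environment ρ).typicalProj δ n

/-- The deviation of a vector from being normalized with typical channel output. -/
def defect (δ : ℝ) (n : ℕ) (c : (Fin n → ι) → ℂ) : ℝ :=
  (∑ x, ‖c x‖ ^ 2 - 1) ^ 2 +
    ∑ z, ‖(((1 - outputProj ρ Λ δ n) * Λ.stinespringPow n) *ᵥ c) z‖ ^ 2

lemma defect_nonneg (δ : ℝ) (n : ℕ) (c : (Fin n → ι) → ℂ) : 0 ≤ defect ρ Λ δ n c := by
  unfold defect
  positivity

lemma continuous_defect_codeword (δ : ℝ) (n : ℕ) :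
    Continuous fun φ => defect ρ Λ δ n (codeword ρ δ n φ) := by
  have := continuous_codeword ρ δ n
  unfold defect
  fun_prop

/-- Apply `integral_mulVec_codeword_le` to `(1 - K) W`. The resulting trace is the weight of the
joint output outside `K`, which the union bound splits between the two marginals. -/
lemma integral_defect_le {δ : ℝ} {n : ℕ} (h : 0 < ρ.typicalWeight δ n) :
    ∫ φ, defect ρ Λ δ n (codeword ρ δ n φ) ∂uniformSphere (ρ.typicalSubspace δ n)
      ≤ (∫ φ, (∑ x, ‖codeword ρ δ n φ x‖ ^ 2 - 1) ^ 2 ∂uniformSphere (ρ.typicalSubspace δ n))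
        + ((1 - (Λ.receiver ρ).typicalWeight δ n) + (1 - (Λ.environment ρ).typicalWeight δ n))
          / ρ.typicalWeight δ n := by
  have := nontrivial_typicalSubspace ρ h
  have hc := continuous_codeword ρ δ n
  unfold defect
  rw [integral_add (integrable_uniformSphere (by fun_prop))
    (integrable_uniformSphere (by fun_prop))]
  refine add_le_add le_rfl ((integral_mulVec_codeword_le ρ h _).trans ?_)
  refine div_le_div_of_nonneg_right ?_ h.le
  have h1 := trace_one_sub_kronecker_le ((Λ.receiver ρ).typicalProj_mul_self δ n)
    ((Λ.receiver ρ).typicalProj_conjTranspose δ n) ((Λ.environment ρ).typicalProj_mul_self δ n)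
    ((Λ.environment ρ).typicalProj_conjTranspose δ n) (Λ.posSemidef_jointOutput ρ n)
  rw [trace_kronecker_one_mul _ _ _ (Λ.sum_jointOutput_env ρ n),
    trace_one_kronecker_mul _ _ _ (Λ.sum_jointOutput_receiver ρ n),
    DensityMatrix.trace_one_sub_typicalProj_mul, DensityMatrix.trace_one_sub_typicalProj_mul,
    Complex.ofReal_re, Complex.ofReal_re] at h1
  refine le_trans (le_of_eq ?_) h1
  rw [Channel.jointOutput, Matrix.conjTranspose_mul, outputProj]
  simp only [Matrix.mul_assoc]

lemma eventually_integral_defect_le {δ τ : ℝ} (hδ : 0 < δ) (hτ : 0 < τ) :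
    ∀ᶠ n in Filter.atTop, 0 < ρ.typicalWeight δ n ∧
      ∫ φ, defect ρ Λ δ n (codeword ρ δ n φ) ∂uniformSphere (ρ.typicalSubspace δ n) ≤ τ := by
  have hA := ρ.tendsto_typicalWeight hδ
  have hB := (Λ.receiver ρ).tendsto_typicalWeight hδ
  have hE := (Λ.environment ρ).tendsto_typicalWeight hδ
  have h2 : Filter.Tendsto (fun n => ((1 - (Λ.receiver ρ).typicalWeight δ n) +
      (1 - (Λ.environment ρ).typicalWeight δ n)) / ρ.typicalWeight δ n) Filter.atTop
      (nhds ((1 - 1 + (1 - 1)) / 1)) :=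
    ((hB.const_sub 1).add (hE.const_sub 1)).div hA one_ne_zero
  rw [sub_self, add_zero, zero_div] at h2
  have hpos : ∀ᶠ n in Filter.atTop, 0 < ρ.typicalWeight δ n :=
    hA.eventually (lt_mem_nhds one_pos)
  have h1 : ∀ᶠ n in Filter.atTop, ∫ φ, (∑ x, ‖codeword ρ δ n φ x‖ ^ 2 - 1) ^ 2
      ∂uniformSphere (ρ.typicalSubspace δ n) ≤ τ / 2 := by
    -- For a pure source the purity is one and the bound by its powers does not decay; there the
    -- variance vanishes exactly.
    rcases ρ.purity_lt_one_or with hp | hp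
    · have hlim : Filter.Tendsto (fun n => (∑ i, ρ.eigenvalue i ^ 2) ^ n /
          ρ.typicalWeight δ n ^ 2) Filter.atTop (nhds (0 / 1 ^ 2)) :=
        (tendsto_pow_atTop_nhds_zero_of_lt_one
          (Finset.sum_nonneg fun i _ => sq_nonneg _) hp).div (hA.pow 2) (by norm_num)
      rw [zero_div] at hlim
      filter_upwards [hpos, hlim.eventually (gt_mem_nhds (half_pos hτ))] with n hn hl
      exact (integral_codeword_norm_sq_sub_one_sq_le ρ hn).trans hl.le
    · filter_upwards [hpos] with n hn
      rw [integral_codeword_norm_sq_sub_one_sq_eq_zero ρ hn hp]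
      exact (half_pos hτ).le
  filter_upwards [hpos, h1, h2.eventually (gt_mem_nhds (half_pos hτ))] with n hn hn1 hn2
  exact ⟨hn, (integral_defect_le ρ Λ hn).trans (by linarith)⟩

variable {a : Type*} [Fintype a] [DecidableEq a] {n N : ℕ}

/-- A code of small average defect has its joint output state close to the projected state. -/
lemma traceNorm_actualState_sub_projectedState_le {ψ : Fin N → EuclideanSpace ℂ a}
    (hψ : Orthonormal ℂ ψ) (hN : 0 < N) (δ : ℝ) (c : Fin N → (Fin n → ι) → ℂ) {s : ℝ}
    (hs : 0 ≤ s) (hs1 : s ≤ 1 / 2) (hc : (∑ α, defect ρ Λ δ n (c α)) / N ≤ s ^ 2) :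
    traceNorm (outer (actualState Λ ψ c) - outer (projectedState ρ Λ δ ψ c)) ≤ 12 * s := by
  have hN' : (0 : ℝ) < N := by exact_mod_cast hN
  set W := Λ.stinespringPow n
  set K := outputProj ρ Λ δ n
  set S := ∑ α, ∑ x, ‖c α x‖ ^ 2 with hS
  have hS0 : 0 ≤ S := by positivity
  have hO : outputSum Λ ψ c = tensorSum ψ fun α => W *ᵥ c α := rfl
  have hOn : ‖WithLp.toLp 2 (outputSum Λ ψ c)‖ = √S := by
    rw [← Real.sqrt_sq (norm_nonneg (WithLp.toLp 2 (outputSum Λ ψ c))), hO, norm_sq_tensorSum hψ]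
    simp_rw [W, sum_norm_sq_mulVec (Λ.stinespringPow_conjTranspose_mul n)]
    rfl
  simp only [defect, Finset.sum_add_distrib, add_div] at hc
  have hA : 0 ≤ (∑ α, (∑ x, ‖c α x‖ ^ 2 - 1) ^ 2) / (N : ℝ) := by positivity
  have hB : 0 ≤ (∑ α, ∑ z, ‖(((1 - K) * W) *ᵥ c α) z‖ ^ 2) / (N : ℝ) := by positivity
  -- Cauchy-Schwarz: the squared mean of `‖c α‖² - 1` is at most the mean of its square.
  have ht : |S / N - 1| ≤ s := by
    refine abs_le_of_sq_le_sq ?_ hs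
    have h1 : S / N - 1 = (∑ α, (∑ x, ‖c α x‖ ^ 2 - 1)) / N := by
      rw [Finset.sum_sub_distrib, ← hS]
      simp [sub_div, hN'.ne']
    have h2 := sq_sum_le_card_mul_sum_sq (s := Finset.univ)
      (f := fun α => ∑ x, ‖c α x‖ ^ 2 - 1)
    rw [Finset.card_univ, Fintype.card_fin] at h2
    calc (S / N - 1) ^ 2 = (∑ α, (∑ x, ‖c α x‖ ^ 2 - 1)) ^ 2 / (N : ℝ) ^ 2 := by rw [h1, div_pow]
      _ ≤ ((N : ℝ) * ∑ α, (∑ x, ‖c α x‖ ^ 2 - 1) ^ 2) / (N : ℝ) ^ 2 := by gcongr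
      _ = (∑ α, (∑ x, ‖c α x‖ ^ 2 - 1) ^ 2) / (N : ℝ) := by field_simp
      _ ≤ s ^ 2 := by linarith
  have hSpos : 0 < S := by
    have h1 := (abs_le.mp ht).1
    have h2 : 0 < S / N := by linarith
    exact (div_pos_iff_of_pos_right hN').mp h2
  have hsS : 0 < √S := Real.sqrt_pos.mpr hSpos
  have hsN : 0 < √(N : ℝ) := Real.sqrt_pos.mpr hN'
  have hu : ‖WithLp.toLp 2 (actualState Λ ψ c)‖ = 1 := by
    rw [actualState, WithLp.toLp_smul, norm_smul, hOn, norm_inv, Complex.norm_real,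
      Real.norm_eq_abs, abs_of_pos hsS, inv_mul_cancel₀ hsS.ne']
  -- The two vectors are parallel at distance `|√(S / N) - 1|`, which is at most `|S / N - 1|` since
  -- `x - 1 = (√x - 1) * (√x + 1)`.
  have huu : ‖WithLp.toLp 2 (actualState Λ ψ c - unnormalizedState Λ ψ c)‖ ≤ s := by
    rw [actualState, unnormalizedState, ← sub_smul, WithLp.toLp_smul, norm_smul, hOn,
      ← Complex.ofReal_inv, ← Complex.ofReal_inv, ← Complex.ofReal_sub, Complex.norm_real,
      Real.norm_eq_abs]
    refine le_trans ?_ ht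
    have e1 : |(√S)⁻¹ - (√(N : ℝ))⁻¹| * √S = |√S / √N - 1| := by
      rw [← abs_of_pos hsS, ← abs_mul, abs_of_pos hsS, sub_mul, inv_mul_cancel₀ hsS.ne',
        abs_sub_comm, div_eq_inv_mul]
    have e2 : S / N - 1 = (√S / √N - 1) * (√S / √N + 1) := by
      have : S / N = (√S / √N) ^ 2 := by rw [div_pow, Real.sq_sqrt hS0, Real.sq_sqrt hN'.le]
      rw [this]; ring
    have hq : 0 ≤ √S / √(N : ℝ) := by positivity
    have e3 : |√S / √(N : ℝ) + 1| = √S / √N + 1 := abs_of_nonneg (by positivity)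
    refine (le_of_eq e1).trans ?_
    rw [e2, abs_mul, e3]
    exact le_mul_of_one_le_right (abs_nonneg _) (by linarith)
  have hv : ‖WithLp.toLp 2 (unnormalizedState Λ ψ c - projectedState ρ Λ δ ψ c)‖ ≤ s := by
    have e1 : unnormalizedState Λ ψ c - projectedState ρ Λ δ ψ c
        = ((√N)⁻¹ : ℂ) • tensorSum ψ fun α => ((1 - K) * W) *ᵥ c α := by
      have e : projectedState ρ Λ δ ψ c
          = ((√N)⁻¹ : ℂ) • tensorSum ψ fun α => K *ᵥ (W *ᵥ c α) := by
        rw [projectedState, unnormalizedState, Matrix.mulVec_smul, hO]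
        congr 1
        exact one_kronecker_mulVec_tensorSum K ψ _
      rw [e, unnormalizedState, hO, ← smul_sub]
      congr 1
      ext z
      simp only [tensorSum, Pi.sub_apply, ← Finset.sum_sub_distrib, ← mul_sub,
        Matrix.sub_mul, Matrix.one_mul, Matrix.sub_mulVec, Matrix.mulVec_mulVec]
    refine abs_le_of_sq_le_sq' ?_ hs |>.2
    rw [e1, WithLp.toLp_smul, norm_smul, mul_pow, norm_sq_tensorSum hψ, norm_inv,
      Complex.norm_real, Real.norm_eq_abs, inv_pow, sq_abs, Real.sq_sqrt hN'.le, ← div_eq_inv_mul]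
    linarith
  have huv : ‖WithLp.toLp 2 (actualState Λ ψ c - projectedState ρ Λ δ ψ c)‖ ≤ 2 * s := by
    rw [← sub_add_sub_cancel _ (unnormalizedState Λ ψ c), WithLp.toLp_add]
    exact (norm_add_le _ _).trans (by linarith)
  -- The norm is at most `1 + 2 * s`, and `s ≤ 1 / 2`.
  have hvn : ‖WithLp.toLp 2 (projectedState ρ Λ δ ψ c)‖ ≤ 2 := by
    have h := norm_sub_norm_le (WithLp.toLp 2 (projectedState ρ Λ δ ψ c))
      (WithLp.toLp 2 (actualState Λ ψ c))
    rw [norm_sub_rev, ← WithLp.toLp_sub] at h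
    linarith
  refine (traceNorm_outer_sub_outer_le _ _).trans ?_
  rw [hu]
  calc _ ≤ 2 * ((1 + 2) * (2 * s)) := by gcongr
    _ = 12 * s := by ring

end Defect

end QCode
end

/-! ### Conclusion by Markov's inequality -/

theorem mainTheorem5 {ι β κ : Type*} [Fintype ι] [Fintype β] [Fintype κ]
    [DecidableEq ι] [DecidableEq β] [DecidableEq κ]
    (ρ : QCode.DensityMatrix ι) (Λ : QCode.Channel ι β κ)
    (δ : ℝ) (hδ : 0 < δ) (ε : ℝ) (hε₀ : 0 < ε) (hε₁ : ε < 1) (η : ℝ) (hη : 0 < η) :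
    ∃ n₀ : ℕ, ∀ n : ℕ, n₀ ≤ n → ∀ N : ℕ, 0 < N →
      ∀ (a : Type*) [Fintype a] [DecidableEq a] (ψ : Fin N → EuclideanSpace ℂ a),
        Orthonormal ℂ ψ →
        MeasureTheory.IsProbabilityMeasure (QCode.codeMeasure ρ δ n N) ∧
        1 - η ≤ (QCode.codeMeasure ρ δ n N).real
          {φ | QCode.traceNorm
            (QCode.outer (QCode.actualState Λ ψ fun α => QCode.codeword ρ δ n (φ α)) -
              QCode.outer (QCode.projectedState ρ Λ δ ψ fun α => QCode.codeword ρ δ n (φ α)))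
            ≤ ε} := by
  -- With `s = ε / 12` the deterministic bound gives `ε`; the factor `η` makes Markov's inequality
  -- at threshold `s ^ 2` give failure probability at most `η`.
  obtain ⟨n₀, hn₀⟩ := Filter.eventually_atTop.mp
    (QCode.eventually_integral_defect_le ρ Λ hδ (τ := η * (ε / 12) ^ 2) (by positivity))
  refine ⟨n₀, fun n hn N hN a _ _ ψ hψ => ?_⟩
  obtain ⟨hpos, hle⟩ := hn₀ n hn
  have hN' : (0 : ℝ) < N := by exact_mod_cast hN
  have := QCode.nontrivial_typicalSubspace ρ hpos
  have hσ := QCode.isProbabilityMeasure_uniformSphere (E := ρ.typicalSubspace δ n)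
  have hμ : MeasureTheory.IsProbabilityMeasure (QCode.codeMeasure ρ δ n N) := by
    unfold QCode.codeMeasure; infer_instance
  refine ⟨hμ, ?_⟩
  set g := fun φ => QCode.defect ρ Λ δ n (QCode.codeword ρ δ n φ)
  have hg : Continuous g := QCode.continuous_defect_codeword ρ Λ δ n
  have hev : ∀ α : Fin N, MeasurePreserving (Function.eval α) (QCode.codeMeasure ρ δ n N)
      (QCode.uniformSphere (ρ.typicalSubspace δ n)) := fun α => measurePreserving_eval _ α
  have hint : ∀ α : Fin N, Integrable (fun φ => g (φ α)) (QCode.codeMeasure ρ δ n N) := fun α =>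
    (hev α).integrable_comp_of_integrable (QCode.integrable_uniformSphere hg)
  have hmean : ∀ α : Fin N, ∫ φ, g (φ α) ∂QCode.codeMeasure ρ δ n N
      = ∫ φ, g φ ∂QCode.uniformSphere (ρ.typicalSubspace δ n) := fun α => by
    rw [← (hev α).map_eq, integral_map (hev α).measurable.aemeasurable
      hg.measurable.aestronglyMeasurable]
  set G : (Fin N → Metric.sphere (0 : ρ.typicalSubspace δ n) 1) → ℝ :=
    fun φ => (∑ α, g (φ α)) / N with hG
  have hGint : Integrable G (QCode.codeMeasure ρ δ n N) :=
    (integrable_finsetSum _ fun α _ => hint α).div_const _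
  have hGmean : ∫ φ, G φ ∂QCode.codeMeasure ρ δ n N ≤ η * (ε / 12) ^ 2 := by
    rw [hG, integral_div, integral_finsetSum _ fun α _ => hint α]
    simp_rw [hmean]
    rw [Finset.sum_const, Finset.card_univ, Fintype.card_fin, nsmul_eq_mul,
      mul_div_cancel_left₀ _ hN'.ne']
    exact hle
  have hGm : Measurable G := by
    have : Measurable g := hg.measurable
    fun_prop
  have hmarkov := mul_meas_ge_le_integral_of_nonneg (μ := QCode.codeMeasure ρ δ n N)
    (Filter.Eventually.of_forall fun φ => div_nonneg
      (Finset.sum_nonneg fun α _ => QCode.defect_nonneg ρ Λ δ n _) hN'.le) hGint ((ε / 12) ^ 2)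
  have hbad : (QCode.codeMeasure ρ δ n N).real {φ | (ε / 12) ^ 2 ≤ G φ} ≤ η := by
    have h := hmarkov.trans hGmean
    rw [mul_comm η] at h
    exact le_of_mul_le_mul_left h (by positivity)
  have hcompl := probReal_compl_eq_one_sub (μ := QCode.codeMeasure ρ δ n N)
    (measurableSet_le measurable_const hGm : MeasurableSet {φ | (ε / 12) ^ 2 ≤ G φ})
  -- Monotonicity needs no measurability of the good event: it contains the measurable set where the
  -- average defect is below the threshold.
  refine le_trans (by rw [hcompl]; linarith) (measureReal_mono
    (s₁ := {φ | (ε / 12) ^ 2 ≤ G φ}ᶜ) fun φ hφ => ?_)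
  have hφ' : G φ ≤ (ε / 12) ^ 2 := (not_le.mp (show ¬ (ε / 12) ^ 2 ≤ G φ from hφ)).le
  refine (QCode.traceNorm_actualState_sub_projectedState_le ρ Λ hψ hN δ _ (s := ε / 12)
    (by positivity) (by linarith) hφ').trans (by linarith)
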